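/- Let $n,k$ be integers with $n>2k\ge 6$, and write $[a,b]=\{a,a+1,\dots,b\}$, $[n]=[1,n]$. For a finite family $\mathcal F$ of subsets of $[n]$, the diversity $\gamma(\mathcal F)$ is $|\mathcal F|$ minus the largest number of members of $\mathcal F$ that contain a common element $i\in[n]$. A family is intersecting if any two of its members intersect. The $(n-k-1)$-cascade form of an integer $0\le\gamma<\binom{n-1}{k-1}$ is the unique representation $$\gamma=\binom{n-b_1}{n-k-1}+\binom{n-b_2}{n-k-2}+\dots+\binom{n-b_s}{n-k-s},\qquad 1<b_1<\dots<b_s,\quad n-b_s\ge n-k-s\ge 1$$ (the empty sum, $s=0$, for $\gamma=0$). Put $T_\gamma=\{b_1,\dots,b_s\}$ and let $S_\gamma$ be the symmetric difference of $T_\gamma$ and $[2,b_s-1]$ ($S_\gamma=\emptyset$ for $\gamma=0$). A nonnegative integer $\gamma$ is called resistant if either $\gamma=\binom{n-4}{k-3}$, or $\gamma$ has such a representation with $|S_\gamma|\le k$, $|T_\gamma|\le k-1$ and $b_i>2i+2$ for every $i\in[1,s]$. There are finitely many resistant numbers; the smallest is $0$ and the largest is $\binom{n-4}{k-3}$, so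 they can be listed as $0=\gamma_0<\gamma_1<\dots<\gamma_m=\binom{n-4}{k-3}$, and each $\gamma_l$ has a unique $(n-k-1)$-cascade form as above. For $l\in[1,m]$ write $S_{\gamma_l}=\{a_1<\dots<a_r\}$ (where $r$ and the $a_i$ depend on $l$) and $$f(l)=\binom{n-a_1}{n-k}+\binom{n-a_2}{n-k-1}+\dots+\binom{n-a_r}{n-k-r+1}+\gamma_l .$$ Then: 1. If $l\in[1,m]$ and $\mathcal F\subset\binom{[n]}{k}$ is an intersecting family with $\gamma_{l-1}<\gamma(\mathcal F)\le\gamma_l$, then $|\mathcal F|\le f(l)$. 2. $f(1)>f(2)>\dots>f(m)$. 3. For every $l\in[1,m]$ there is an intersecting family $\mathcal F\subset\binom{[n]}{k}$ with $\gamma(\mathcal F)=\gamma_l$ and $|\mathcal F|=f(l)$. -/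

import Mathlib

/-- The position of `x` in `T`: if `T = {b₁ < b₂ < … < b_s}`, then `rankIn T b_i = i`. -/
def rankIn (T : Finset ℕ) (x : ℕ) : ℕ := (T.filter (fun y => y ≤ x)).card

/-- If `T = {b₁ < … < b_s}`, this is `∑ i, (n - b_i choose q - i)`, with `i` from `1` to `s`. -/
def cascadeSum (n q : ℕ) (T : Finset ℕ) : ℕ :=
  ∑ x ∈ T, (n - x).choose (q - rankIn T x)

/-- `T = {b₁ < … < b_s}`, with `1 < b₁`, is the index set of the `(n-k-1)`-cascade form of `g`:
`g = (n - b₁ choose n-k-1) + (n - b₂ choose n-k-2) + … + (n - b_s choose n-k-s)`, with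
`n - b_i ≥ n-k-i ≥ 1` for all `i`. The empty set belongs to `g = 0`. -/
def IsCascadeSet (n k g : ℕ) (T : Finset ℕ) : Prop :=
  (∀ x ∈ T, 1 < x ∧ 1 ≤ n - k - rankIn T x ∧ n - k - rankIn T x ≤ n - x) ∧
    g = cascadeSum n (n - k) T

/-- If `b` is the largest element of `T`, this is the symmetric difference of `T` and
`[2, b - 1]`; it is empty if `T` is. -/
def dualSet (T : Finset ℕ) : Finset ℕ := symmDiff T (Finset.Ico 2 (T.sup id))

/-- `g` is a resistant number (with respect to `n` and `k`). -/
def IsResistant (n k g : ℕ) : Prop :=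
  g = (n - 4).choose (k - 3) ∨
    ∃ T : Finset ℕ, IsCascadeSet n k g T ∧
      (dualSet T).card ≤ k ∧ T.card ≤ k - 1 ∧
      ∀ x ∈ T, 2 * rankIn T x + 2 < x

/-- The number of members of `F` that contain `i`. -/
def degreeIn (F : Finset (Finset ℕ)) (i : ℕ) : ℕ := (F.filter (fun A => i ∈ A)).card

/-- The diversity of a family of subsets of `{1, …, n}`: its size minus its maximal degree. -/
def diversity (n : ℕ) (F : Finset (Finset ℕ)) : ℕ :=
  F.card - (Finset.Icc 1 n).sup (degreeIn F)

/-- `F` is an intersecting family of `k`-element subsets of `{1, …, n}`. -/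
def IsIntersectingFamily (n k : ℕ) (F : Finset (Finset ℕ)) : Prop :=
  F ⊆ (Finset.Icc 1 n).powersetCard k ∧ ∀ A ∈ F, ∀ B ∈ F, (A ∩ B).Nonempty

/-- If `T = {b₁ < … < b_s}` gives the cascade form of `g` and `dualSet T = {a₁ < … < a_r}`, this
is `(n - a₁ choose n-k) + (n - a₂ choose n-k-1) + … + (n - a_r choose n-k-r+1) + g`. -/
def familyBound (n k g : ℕ) (T : Finset ℕ) : ℕ :=
  cascadeSum n (n - k + 1) (dualSet T) + g

/-! Take an element `i` of maximal degree. The members avoiding `i` and the members containing `i`,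
with `i` removed, form a cross-intersecting pair on `n - 1` points, and the diversity is the size of
the first family. By Kruskal-Katona (`card_le_dualCount`), once the first size is fixed the second
is largest when the first family is a lexicographic initial segment.

Such a segment is encoded by a Boolean word `w`: it has `upCount` members, the sets meeting all of
them number `dualCount`, and `pairCount` is the sum. Here `m` is the number of points left and `r`,
`s` are the complement sizes of the two families. Reading `true` lowers `m` and `s` by one, reading
`false` lowers `m` and `r` by one. So `m - r - s` is invariant and stays negative, which is where `n
> 2k` enters, while `r - s` performs a walk with steps `+1` and `-1`. For diversity at most `(n -
4).choose (k - 3)` the word can start with three letters `true`, after which `r - s = 2`. The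
condition `b_i > 2i + 2` is a ballot condition: `r - s` is at least `2` before each later `false`
and before the last letter (`resWord_iff`).

The upper bound comes from truncation. When the walk is about to violate the condition, the rest of
the word can be dropped: both counts are at least as large as before, because a pair with `r = s`
after the step is no larger than a trivial one (`pairCount_le_max`). The result is the least
resistant number above the diversity (`exists_resWord_ge`).

Strict decrease comes from a sandwich: the pair of a resistant word lies strictly between `m.choose
r` and `m.choose s`. At the first letter where two words differ, this makes the branch `true`, which
has the smaller diversity, strictly larger (`pairCount_anti`). Equality is attained by the
lexicographic pairs themselves, with the element `1` added to the sets of the second family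
(`exists_family`). -/

/-! ### Monotonicity of binomial coefficients away from the middle -/

theorem choose_succ_lt_choose {M j : ℕ} (hj : j ≤ M) (h : M < 2 * j + 1) :
    M.choose (j + 1) < M.choose j := by
  have e := Nat.choose_succ_right_eq M j
  have hp : 0 < M.choose j := Nat.choose_pos hj
  by_contra hc
  push Not at hc
  have h1 : M.choose j * (M - j) < M.choose (j + 1) * (j + 1) :=
    lt_of_lt_of_le (Nat.mul_lt_mul_of_pos_left (by omega) hp) (Nat.mul_le_mul_right _ hc)
  omega

theorem choose_lt_choose_of_half_le {M a b : ℕ} (ha : a ≤ M) (h : M ≤ 2 * a) (hab : a < b) :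
    M.choose b < M.choose a := by
  induction b, hab using Nat.le_induction with
  | base => exact choose_succ_lt_choose ha (by omega)
  | succ b hb ih =>
    by_cases hbM : b ≤ M
    · exact (choose_succ_lt_choose hbM (by omega)).trans ih
    · rw [Nat.choose_eq_zero_of_lt (by omega)]
      exact Nat.choose_pos ha

/-- Binomial coefficients decrease strictly with the distance from the middle. -/
theorem choose_lt_choose_of_lt_add {M a b : ℕ} (ha : a ≤ M) (hab : a < b) (h : M < a + b) :
    M.choose b < M.choose a := by
  by_cases h2 : M ≤ 2 * a
  · exact choose_lt_choose_of_half_le ha h2 hab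
  · rw [← Nat.choose_symm ha]
    exact choose_lt_choose_of_half_le (by omega) (by omega) (by omega)

theorem choose_le_choose_of_le_add {M a b : ℕ} (hab : a ≤ b) (h : M ≤ a + b) :
    M.choose b ≤ M.choose a := by
  rcases hab.eq_or_lt with rfl | hlt
  · rfl
  by_cases hb : b ≤ M
  · rcases h.eq_or_lt with h' | h'
    · rw [← Nat.choose_symm hb, show M - b = a by omega]
    · exact (choose_lt_choose_of_lt_add (by omega) hlt h').le
  · rw [Nat.choose_eq_zero_of_lt (by omega)]
    exact Nat.zero_le _

/-! ### Words and the sizes of the pairs they encode -/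

/-- The number of sets `B` in a ground set of `m` elements, with complement of size `r`, whose
characteristic vector is lexicographically at least the word `w` (on the length of `w`). -/
def upCount : ℕ → ℕ → List Bool → ℕ
  | m, r, [] => m.choose r
  | m, r, true :: w => upCount (m - 1) r w
  | m, r, false :: w => (m - 1).choose r + upCount (m - 1) (r - 1) w

/-- The number of sets, in a ground set of `m` elements and with complement of size `s`, which
intersect all the sets counted by `upCount` for `w`. -/
def dualCount : ℕ → ℕ → List Bool → ℕ
  | _, _, [] => 0
  | m, s, true :: w => (m - 1).choose s + dualCount (m - 1) (s - 1) w
  | m, s, false :: w => dualCount (m - 1) s w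

/-- The size of the cross-intersecting pair of families given by the word `w`. -/
def pairCount (m r s : ℕ) (w : List Bool) : ℕ := upCount m r w + dualCount m s w

/-- The word `w` is the beginning of the characteristic vector of some set in a ground set of `m`
elements, with complement of size `r`. -/
def Fits : ℕ → ℕ → List Bool → Prop
  | m, r, [] => r ≤ m
  | m, r, true :: w => r < m ∧ Fits (m - 1) r w
  | m, r, false :: w => 1 ≤ r ∧ r ≤ m ∧ Fits (m - 1) (r - 1) w

/-- The condition on `v` that makes the set with characteristic vector `v ++ [true]` resistant. -/
def ResWord : ℕ → ℕ → ℕ → List Bool → Prop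
  | m, r, s, [] => s + 1 < r ∧ r < m
  | m, r, s, true :: v => ResWord (m - 1) r (s - 1) v
  | m, r, s, false :: v => s + 1 < r ∧ ResWord (m - 1) (r - 1) s v

theorem pairCount_true (m r s : ℕ) (w : List Bool) :
    pairCount (m + 1) r s (true :: w) = m.choose s + pairCount m r (s - 1) w := by
  simp [pairCount, upCount, dualCount]; omega

theorem pairCount_false (m r s : ℕ) (w : List Bool) :
    pairCount (m + 1) r s (false :: w) = m.choose r + pairCount m (r - 1) s w := by
  simp [pairCount, upCount, dualCount]; omega

theorem pairCount_nil (m r s : ℕ) : pairCount m r s [] = m.choose r := by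
  simp [pairCount, upCount, dualCount]

theorem Fits.le {m r : ℕ} {w : List Bool} (h : Fits m r w) : r ≤ m := by
  cases w with
  | nil => exact h
  | cons b w => cases b <;> simp only [Fits] at h <;> omega

theorem choose_succ_of_pos (m : ℕ) {r : ℕ} (hr : 1 ≤ r) :
    (m + 1).choose r = m.choose r + m.choose (r - 1) := by
  obtain ⟨r, rfl⟩ := Nat.exists_eq_add_of_le' hr
  rw [Nat.choose_succ_succ', Nat.add_sub_cancel, add_comm]

theorem upCount_pos {m r : ℕ} {w : List Bool} (h : Fits m r w) : 0 < upCount m r w := by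
  induction w generalizing m r with
  | nil => exact Nat.choose_pos h
  | cons b w ih =>
    cases b
    · have := ih h.2.2
      simp only [upCount]; omega
    · exact ih h.2

theorem upCount_le {m r : ℕ} {w : List Bool} (h : Fits m r w) : upCount m r w ≤ m.choose r := by
  induction w generalizing m r with
  | nil => exact le_rfl
  | cons b w ih =>
    cases b
    · obtain ⟨h1, h2, h3⟩ := h
      obtain ⟨M, rfl⟩ : ∃ M, m = M + 1 := ⟨m - 1, by omega⟩
      rw [choose_succ_of_pos M h1]
      exact Nat.add_le_add_left (ih h3) _
    · obtain ⟨h1, h2⟩ := h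
      exact (ih h2).trans (Nat.choose_le_choose _ (by omega))

/-- Every number up to `m.choose r` is counted by some word. -/
theorem exists_upCount_eq {m r g : ℕ} (h0 : 0 < g) (hg : g ≤ m.choose r) :
    ∃ w, Fits m r w ∧ upCount m r w = g := by
  have hr : r ≤ m := by
    by_contra hc
    rw [Nat.choose_eq_zero_of_lt (by omega)] at hg
    omega
  induction m generalizing r g with
  | zero =>
    obtain rfl : r = 0 := by omega
    exact ⟨[], by simp [Fits], by simp [upCount] at *; omega⟩
  | succ m ih =>
    by_cases h1 : g ≤ m.choose r
    · have hrm : r ≤ m := by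
        by_contra hc
        rw [Nat.choose_eq_zero_of_lt (by omega)] at h1
        omega
      obtain ⟨w, hw, hw'⟩ := ih h0 h1 hrm
      exact ⟨true :: w, ⟨by omega, hw⟩, hw'⟩
    · have hr1 : 1 ≤ r := by
        by_contra hc
        obtain rfl : r = 0 := by omega
        simp at hg h1
        omega
      rw [choose_succ_of_pos m hr1] at hg
      obtain ⟨w, hw, hw'⟩ := ih (r := r - 1) (g := g - m.choose r) (by omega) (by omega) (by omega)
      exact ⟨false :: w, ⟨hr1, hr, hw⟩, by simp [upCount, hw']; omega⟩

/-! ### Size bounds and truncation to resistant words -/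

/-- Each of the two trivial pairs consists of all sets on one side and none on the other. By
Pascal's rule, a letter combined with a trivial remainder is either a trivial pair or a mixed sum of
binomials dominated by one. The truncation needs the case `r = s`, where the two bounds coincide. -/
theorem pairCount_le_max {m r s : ℕ} {w : List Bool} (h : m ≤ r + s) (hw : Fits m r w) :
    pairCount m r s w ≤ max (m.choose r) (m.choose s) := by
  induction w generalizing m r s with
  | nil => rw [pairCount_nil]; exact le_max_left _ _
  | cons b w ih =>
    obtain ⟨M, rfl⟩ : ∃ M, m = M + 1 := ⟨m - 1, by cases b <;> simp only [Fits] at hw <;> omega⟩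
    cases b
    · obtain ⟨h1, h2, h3⟩ := hw
      rw [pairCount_false, choose_succ_of_pos M h1]
      have := ih (s := s) (by simp; omega) h3
      simp only [Nat.add_sub_cancel] at this
      rcases le_max_iff.1 this with h4 | h4
      · exact le_max_of_le_left (by omega)
      -- The mixed sum `M.choose r + M.choose s` is left; the smaller of `r` and `s` tells which
      -- Pascal sum dominates it.
      by_cases hs : r ≤ s
      · have := choose_le_choose_of_le_add (M := M) (a := r - 1) (b := s) (by omega) (by omega)
        exact le_max_of_le_left (by omega)
      · by_cases hs0 : s = 0
        · subst hs0
          have := Nat.choose_eq_zero_of_lt (n := M) (k := r) (by omega)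
          simp at h4 ⊢
          omega
        · rw [choose_succ_of_pos M (r := s) (by omega)]
          have := choose_le_choose_of_le_add (M := M) (a := s - 1) (b := r) (by omega) (by omega)
          exact le_max_of_le_right (by omega)
    · obtain ⟨h1, h2⟩ := hw
      have hs : 1 ≤ s := by omega
      rw [pairCount_true, choose_succ_of_pos M hs]
      have := ih (s := s - 1) (by simp; omega) h2
      simp only [Nat.add_sub_cancel] at this
      rcases le_max_iff.1 this with h4 | h4
      swap
      · exact le_max_of_le_right (by omega)
      by_cases hr : s ≤ r
      · have := choose_le_choose_of_le_add (M := M) (a := s - 1) (b := r) (by omega) (by omega)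
        exact le_max_of_le_right (by omega)
      · by_cases hr0 : r = 0
        · subst hr0
          have := Nat.choose_eq_zero_of_lt (n := M) (k := s) (by omega)
          simp at h4 ⊢
          omega
        · rw [choose_succ_of_pos M (r := r) (by omega)]
          have := choose_le_choose_of_le_add (M := M) (a := r - 1) (b := s) (by omega) (by omega)
          exact le_max_of_le_left (by omega)

theorem ResWord.lt {m r s : ℕ} {v : List Bool} (h : ResWord m r s v) : r < m ∧ 1 ≤ r := by
  induction v generalizing m r s with
  | nil => simp only [ResWord] at h; omega
  | cons b v ih =>
    cases b
    · have := ih h.2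
      have := h.1
      omega
    · have := ih (m := m - 1) (s := s - 1) h
      omega

theorem ResWord.fits {m r s : ℕ} {v : List Bool} (h : ResWord m r s v) :
    Fits m r (v ++ [true]) := by
  induction v generalizing m r s with
  | nil => simp only [ResWord] at h; simp only [List.nil_append, Fits]; omega
  | cons b v ih =>
    have := h.lt
    cases b
    · exact ⟨by omega, by omega, ih h.2⟩
    · exact ⟨by omega, ih h⟩

theorem ResWord.upCount_lt {m r s : ℕ} {v : List Bool} (h : ResWord m r s v) :
    upCount m r (v ++ [true]) < m.choose r := by
  have hl := h.lt
  obtain ⟨M, rfl⟩ : ∃ M, m = M + 1 := ⟨m - 1, by omega⟩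
  induction v generalizing M r s with
  | nil =>
    rw [choose_succ_of_pos M hl.2]
    have : 0 < M.choose (r - 1) := Nat.choose_pos (by omega)
    simpa [upCount] using this
  | cons b v ih =>
    rw [choose_succ_of_pos M hl.2]
    cases b
    · have h2 := h.2.lt
      simp only [Nat.add_sub_cancel] at h2
      obtain ⟨M', rfl⟩ : ∃ M', M = M' + 1 := ⟨M - 1, by omega⟩
      exact Nat.add_lt_add_left (ih M' h.2 h2) _
    · have h2 := upCount_le (ResWord.fits (v := v) (m := M) (s := s - 1) h)
      have : 0 < M.choose (r - 1) := Nat.choose_pos (by omega)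
      change upCount M r (v ++ [true]) < _
      omega

/-- Every word can be replaced by a resistant one, or by the empty one, such that the number of
members of the pair of families does not decrease; the count `upCount` of the new word is the
smallest possible. -/
theorem exists_resWord_ge {m r s : ℕ} {w : List Bool} (hsr : s < r) (hm : m < r + s)
    (hw : Fits m r w) :
    ∃ w', (w' = [] ∨ ∃ v, w' = v ++ [true] ∧ ResWord m r s v) ∧
      upCount m r w ≤ upCount m r w' ∧ pairCount m r s w ≤ pairCount m r s w' ∧
      ∀ v, ResWord m r s v → upCount m r w ≤ upCount m r (v ++ [true]) →
        upCount m r w' ≤ upCount m r (v ++ [true]) ∧ w' ≠ [] := by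
  induction w generalizing m r s with
  | nil =>
    refine ⟨[], Or.inl rfl, le_rfl, le_rfl, fun v hv h => ?_⟩
    have := hv.upCount_lt
    simp only [upCount] at h
    omega
  | cons b w ih =>
    obtain ⟨M, rfl⟩ : ∃ M, m = M + 1 := ⟨m - 1, by cases b <;> simp only [Fits] at hw <;> omega⟩
    cases b
    · obtain ⟨h1, h2, h3⟩ := hw
      have hpos := upCount_pos h3
      simp only [Nat.add_sub_cancel] at h3 hpos
      by_cases hs : s + 1 < r
      · obtain ⟨w', hw', hu, hp, hmin⟩ := ih (m := M) (r := r - 1) (s := s) (by omega) (by omega) h3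
        -- A resistant competitor must also start with `false`: words starting with `true` count at
        -- most `M.choose r`, while `w` adds a positive amount to that.
        have key : ∀ v, ResWord (M + 1) r s v →
            upCount (M + 1) r (false :: w) ≤ upCount (M + 1) r (v ++ [true]) →
            ∃ v', v = false :: v' ∧ ResWord M (r - 1) s v' ∧
              upCount M (r - 1) w ≤ upCount M (r - 1) (v' ++ [true]) := by
          intro v hv hle
          rcases v with _ | ⟨b, v⟩
          · simp only [upCount, List.nil_append, Nat.add_sub_cancel] at hle
            omega
          cases b
          · refine ⟨v, rfl, hv.2, ?_⟩
            simp only [upCount, List.cons_append, Nat.add_sub_cancel] at hle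
            omega
          · have h4 := upCount_le (ResWord.fits (v := v) (m := M) (r := r) (s := s - 1) hv)
            simp only [upCount, List.cons_append, Nat.add_sub_cancel] at hle
            omega
        rcases hw' with rfl | ⟨v, rfl, hv⟩
        · refine ⟨[], Or.inl rfl, ?_, ?_, ?_⟩
          · simp only [upCount, Nat.add_sub_cancel] at hu ⊢
            rw [choose_succ_of_pos M h1]
            omega
          · rw [pairCount_nil] at hp ⊢
            rw [pairCount_false, choose_succ_of_pos M h1]
            omega
          · intro v hv hle
            obtain ⟨v', rfl, hv', hle'⟩ := key v hv hle
            exact absurd rfl (hmin v' hv' hle').2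
        · refine ⟨false :: v ++ [true], Or.inr ⟨false :: v, rfl, hs, hv⟩, ?_, ?_, ?_⟩
          · simpa [upCount] using hu
          · rw [List.cons_append, pairCount_false, pairCount_false]
            omega
          · intro v hv hle
            obtain ⟨v', rfl, hv', hle'⟩ := key v hv hle
            exact ⟨by simpa [upCount] using (hmin v' hv' hle').1, by simp⟩
      -- The walk would reach `r - s = 0` here, so the word is cut. The remainder has equal
      -- complement sizes `s`, hence total at most `M.choose s`, which is what Pascal's rule
      -- supplies for the empty word.
      · obtain rfl : r = s + 1 := by omega
        refine ⟨[], Or.inl rfl, ?_, ?_, ?_⟩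
        · exact upCount_le (w := false :: w) ⟨h1, h2, h3⟩
        · rw [pairCount_nil, pairCount_false, choose_succ_of_pos M h1]
          have := pairCount_le_max (s := s) (by omega) h3
          simp only [Nat.add_sub_cancel, max_self] at this ⊢
          omega
        · intro v hv hle
          exfalso
          rcases v with _ | ⟨b, v⟩
          · simp only [ResWord] at hv
            omega
          cases b
          · have := hv.1
            omega
          · have h4 := upCount_le (ResWord.fits (v := v) (m := M) (r := s + 1) (s := s - 1) hv)
            simp only [upCount, List.cons_append, Nat.add_sub_cancel] at hle hpos
            omega
    · obtain ⟨h1, h2⟩ := hw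
      simp only [Nat.add_sub_cancel] at h2
      obtain ⟨w', hw', hu, hp, hmin⟩ := ih (m := M) (r := r) (s := s - 1) (by omega) (by omega) h2
      have hs1 : 1 ≤ s := by omega
      rcases hw' with rfl | ⟨v, rfl, hv⟩
      · by_cases hs : s + 1 < r
        · refine ⟨[true], Or.inr ⟨[], rfl, hs, h1⟩, hu, ?_, ?_⟩
          · rw [pairCount_true, pairCount_true]
            omega
          · intro v hv hle
            refine ⟨?_, by simp⟩
            rcases v with _ | ⟨b, v⟩
            · exact le_rfl
            cases b
            · simp [upCount]
            · exact absurd rfl (hmin v hv hle).2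
        -- Ending with `true` at `r = s + 1` gives the same total as the empty word, by Pascal's
        -- rule, so the larger family is kept.
        · obtain rfl : r = s + 1 := by omega
          refine ⟨[], Or.inl rfl, upCount_le (w := true :: w) ⟨h1, h2⟩, ?_, ?_⟩
          · rw [pairCount_nil] at hp ⊢
            rw [pairCount_true, choose_succ_of_pos M (by omega)]
            simp only [Nat.add_sub_cancel]
            omega
          · intro v hv hle
            exfalso
            rcases v with _ | ⟨b, v⟩
            · simp only [ResWord] at hv
              omega
            cases b
            · have := hv.1
              omega
            · exact absurd rfl (hmin v hv hle).2
      · refine ⟨true :: v ++ [true], Or.inr ⟨true :: v, rfl, hv⟩, hu, ?_, ?_⟩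
        · rw [List.cons_append, pairCount_true, pairCount_true]
          omega
        · intro v' hv' hle
          refine ⟨?_, by simp⟩
          have h4 := upCount_le (ResWord.fits hv)
          rcases v' with _ | ⟨b, v'⟩
          · exact h4
          cases b
          · simp only [upCount, List.cons_append, Nat.add_sub_cancel]
            omega
          · exact (hmin v' hv' hle).1

/-! ### Strict decrease of the bound along resistant words -/

/-- Expand `m.choose r` by Pascal's rule. After `false` the first summands agree; after `true` the
gain is `M.choose s` against `M.choose (r - 1)`. At the end of `v`, the gap `s + 1 < r` makes this
gain strict. -/
theorem choose_lt_pairCount {m r s : ℕ} {v : List Bool} (hsr : s < r) (hm : m < r + s)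
    (hv : ResWord m r s v) : m.choose r < pairCount m r s (v ++ [true]) := by
  have hl := hv.lt
  obtain ⟨M, rfl⟩ : ∃ M, m = M + 1 := ⟨m - 1, by omega⟩
  induction v generalizing M r s with
  | nil =>
    have h1 := hv.1
    rw [List.nil_append, pairCount_true, pairCount_nil, choose_succ_of_pos M hl.2]
    have := choose_lt_choose_of_lt_add (M := M) (a := s) (b := r - 1) (by omega) (by omega)
      (by omega)
    omega
  | cons b v ih =>
    rw [choose_succ_of_pos M hl.2]
    cases b
    · have h1 := hv.1
      have h2 := hv.2.lt
      simp only [Nat.add_sub_cancel] at h2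
      obtain ⟨M', rfl⟩ : ∃ M', M = M' + 1 := ⟨M - 1, by omega⟩
      rw [List.cons_append, pairCount_false]
      exact Nat.add_lt_add_left (ih (by omega) M' (by omega) hv.2 h2) _
    · have hv' : ResWord M r (s - 1) v := hv
      have h2 := hv'.lt
      obtain ⟨M', rfl⟩ : ∃ M', M = M' + 1 := ⟨M - 1, by omega⟩
      rw [List.cons_append, pairCount_true]
      have h3 := ih (s := s - 1) (by omega) M' (by omega) hv' h2
      have := choose_le_choose_of_le_add (M := M' + 1) (a := s) (b := r - 1) (by omega) (by omega)
      omega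

/-- The mirror image of `choose_lt_pairCount`, with `m.choose s` expanded and the roles of the two
letters exchanged. -/
theorem pairCount_lt_choose {m r s : ℕ} {v : List Bool} (hsr : s < r) (hm : m < r + s)
    (hv : ResWord m r s v) : pairCount m r s (v ++ [true]) < m.choose s := by
  have hl := hv.lt
  obtain ⟨M, rfl⟩ : ∃ M, m = M + 1 := ⟨m - 1, by omega⟩
  induction v generalizing M r s with
  | nil =>
    rw [List.nil_append, pairCount_true, pairCount_nil, choose_succ_of_pos M (r := s) (by omega)]
    have := choose_lt_choose_of_lt_add (M := M) (a := s - 1) (b := r) (by omega) (by omega)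
      (by omega)
    omega
  | cons b v ih =>
    rw [choose_succ_of_pos M (r := s) (by omega)]
    cases b
    · have h1 := hv.1
      have h2 := hv.2.lt
      simp only [Nat.add_sub_cancel] at h2
      obtain ⟨M', rfl⟩ : ∃ M', M = M' + 1 := ⟨M - 1, by omega⟩
      rw [List.cons_append, pairCount_false]
      have h3 := ih (by omega) M' (by omega) hv.2 h2
      have := choose_le_choose_of_le_add (M := M' + 1) (a := s - 1) (b := r) (by omega) (by omega)
      omega
    · have hv' : ResWord M r (s - 1) v := hv
      have h2 := hv'.lt
      obtain ⟨M', rfl⟩ : ∃ M', M = M' + 1 := ⟨M - 1, by omega⟩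
      rw [List.cons_append, pairCount_true]
      exact Nat.add_lt_add_left (ih (s := s - 1) (by omega) M' (by omega) hv' h2) _

/-- At the first difference, the word with `true` has total above `M.choose s + M.choose r` and the
one with `false` has total below it, by the sandwich applied to the remainders. A word that ends
there has total exactly this sum. -/
theorem pairCount_anti {m r s : ℕ} {v v' : List Bool} (hsr : s < r) (hm : m < r + s)
    (hv : ResWord m r s v) (hv' : ResWord m r s v')
    (h : upCount m r (v ++ [true]) < upCount m r (v' ++ [true])) :
    pairCount m r s (v' ++ [true]) < pairCount m r s (v ++ [true]) := by
  induction v generalizing m r s v' with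
  | nil =>
    have hl := hv.lt
    obtain ⟨M, rfl⟩ : ∃ M, m = M + 1 := ⟨m - 1, by omega⟩
    rcases v' with _ | ⟨b', v'⟩
    · exact absurd h (lt_irrefl _)
    cases b'
    · have h1 := hv'.1
      have := pairCount_lt_choose (m := M) (r := r - 1) (by omega) (by omega) hv'.2
      rw [List.cons_append, List.nil_append, pairCount_false, pairCount_true, pairCount_nil]
      omega
    · exact absurd h (not_lt.2 (upCount_le (ResWord.fits (v := v') (m := M) (s := s - 1) hv')))
  | cons b v ih =>
    have hl := hv.lt
    obtain ⟨M, rfl⟩ : ∃ M, m = M + 1 := ⟨m - 1, by omega⟩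
    cases b
    · have h1 := hv.1
      have hrest : ¬ upCount (M + 1) r (false :: v ++ [true]) < M.choose r := by
        simp [upCount]
      rcases v' with _ | ⟨b', v'⟩
      · have h' : upCount (M + 1) r ([] ++ [true]) = M.choose r := by simp [upCount]
        omega
      cases b'
      · simp only [List.cons_append, pairCount_false]
        refine Nat.add_lt_add_left (ih (by omega) (by omega) hv.2 hv'.2 ?_) _
        simpa [upCount] using h
      · have h4 : upCount (M + 1) r (true :: v' ++ [true]) ≤ M.choose r :=
          upCount_le (ResWord.fits (v := v') (m := M) (s := s - 1) hv')
        omega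
    · have hc : ResWord M r (s - 1) v := hv
      have h3 := choose_lt_pairCount (m := M) (s := s - 1) (by omega) (by omega) hc
      rcases v' with _ | ⟨b', v'⟩
      · rw [List.cons_append, List.nil_append, pairCount_true, pairCount_true, pairCount_nil]
        omega
      cases b'
      · have h1 := hv'.1
        have := pairCount_lt_choose (m := M) (r := r - 1) (by omega) (by omega) hv'.2
        rw [List.cons_append, List.cons_append, pairCount_false, pairCount_true]
        omega
      · simp only [List.cons_append, pairCount_true]
        exact Nat.add_lt_add_left (ih (m := M) (s := s - 1) (by omega) (by omega) hc hv' h) _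

/-! ### Dictionary between words and cascade forms -/

/-- The positions, starting from `c`, of the entries `false` in `u`, together with the position
after the last entry. -/
def wordSet : ℕ → List Bool → Finset ℕ
  | c, [] => {c}
  | c, true :: u => wordSet (c + 1) u
  | c, false :: u => insert c (wordSet (c + 1) u)

/-- The word `u` describes a cascade form, where `u ++ [true]` fits. -/
def CascadeWord : ℕ → ℕ → List Bool → Prop
  | m, r, [] => 1 ≤ r ∧ r < m
  | m, r, true :: u => CascadeWord (m - 1) r u
  | m, r, false :: u => CascadeWord (m - 1) (r - 1) u

/-- The positions `x` of `wordSet c u` satisfy `2 * rankIn (wordSet c u) x + e < x`. -/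
def SparseWord : ℕ → ℕ → List Bool → Prop
  | c, e, [] => 2 + e < c
  | c, e, true :: u => SparseWord (c + 1) e u
  | c, e, false :: u => 2 + e < c ∧ SparseWord (c + 1) (e + 2) u

theorem le_of_mem_wordSet {c : ℕ} {u : List Bool} {x : ℕ} (h : x ∈ wordSet c u) : c ≤ x := by
  induction u generalizing c with
  | nil => simp only [wordSet, Finset.mem_singleton] at h; omega
  | cons b u ih =>
    cases b
    · simp only [wordSet, Finset.mem_insert] at h
      rcases h with rfl | h
      · rfl
      · have := ih h; omega
    · have := ih (c := c + 1) h; omega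

theorem notMem_wordSet_succ (c : ℕ) (u : List Bool) : c ∉ wordSet (c + 1) u := fun h => by
  have := le_of_mem_wordSet h
  omega

theorem sup_wordSet (c : ℕ) (u : List Bool) : (wordSet c u).sup id = c + u.length := by
  induction u generalizing c with
  | nil => simp [wordSet]
  | cons b u ih =>
    cases b
    · simp only [wordSet, Finset.sup_insert, ih, List.length_cons, id]
      omega
    · simp only [wordSet, ih, List.length_cons]
      omega

theorem exists_wordSet_eq {c : ℕ} {T : Finset ℕ} (hT : T.Nonempty) (hc : ∀ x ∈ T, c ≤ x) :
    ∃ u, T = wordSet c u := by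
  obtain ⟨d, hd⟩ : ∃ d, ∀ x ∈ T, x ≤ c + d :=
    ⟨T.sup id, fun x hx => (Finset.le_sup (f := id) hx).trans (Nat.le_add_left _ _)⟩
  induction d generalizing c T with
  | zero =>
    refine ⟨[], ?_⟩
    obtain ⟨y, hy⟩ := hT
    ext x
    simp only [wordSet, Finset.mem_singleton]
    constructor
    · intro hx
      have := hc x hx
      have := hd x hx
      omega
    · rintro rfl
      have := hc y hy
      have := hd y hy
      obtain rfl : y = x := by omega
      exact hy
  | succ d ih =>
    by_cases hcT : c ∈ T
    · rcases (T.erase c).eq_empty_or_nonempty with h0 | h0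
      · refine ⟨[], ?_⟩
        rw [← Finset.insert_erase hcT, h0]
        rfl
      · obtain ⟨u, hu⟩ := ih (c := c + 1) h0
          (fun x hx => by
            have := Finset.ne_of_mem_erase hx
            have := hc x (Finset.mem_of_mem_erase hx)
            omega)
          (fun x hx => by
            have := hd x (Finset.mem_of_mem_erase hx)
            omega)
        exact ⟨false :: u, by rw [wordSet, ← hu, Finset.insert_erase hcT]⟩
    · obtain ⟨u, hu⟩ := ih (c := c + 1) hT
        (fun x hx => by
          have : x ≠ c := fun h => hcT (h ▸ hx)
          have := hc x hx
          omega)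
        (fun x hx => by
          have := hd x hx
          omega)
      exact ⟨true :: u, hu⟩

theorem mem_wordSet_map_not {c : ℕ} {u : List Bool} {x : ℕ} :
    x ∈ wordSet c (u.map (! ·)) ↔
      x = c + u.length ∨ (x ∈ Finset.Ico c (c + u.length) ∧ x ∉ wordSet c u) := by
  induction u generalizing c with
  | nil => simp [wordSet]
  | cons b u ih =>
    have hc := notMem_wordSet_succ c u
    cases b
    · simp only [List.map_cons, Bool.not_false, wordSet, ih, List.length_cons, Finset.mem_Ico,
        Finset.mem_insert]
      by_cases hx : x = c
      · subst hx
        simp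
        omega
      · simp only [hx, false_or]
        refine or_congr (by omega) (and_congr_left fun _ => by omega)
    · simp only [List.map_cons, Bool.not_true, wordSet, ih, List.length_cons, Finset.mem_Ico,
        Finset.mem_insert]
      by_cases hx : x = c
      · subst hx; simp [hc]
      · simp only [hx, false_or]
        refine or_congr (by omega) (and_congr_left fun _ => by omega)

theorem last_mem_wordSet (c : ℕ) (u : List Bool) : c + u.length ∈ wordSet c u := by
  induction u generalizing c with
  | nil => simp [wordSet]
  | cons b u ih =>
    have : c + (b :: u).length = c + 1 + u.length := by simp; omega
    rw [this]
    cases b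
    · exact Finset.mem_insert_of_mem (ih _)
    · exact ih _

/-- The largest element is the end position, and below it the symmetric difference is the complement
within the interval starting at `2`. Thus passing to `S_γ` flips every letter and keeps the end. -/
theorem dualSet_wordSet (u : List Bool) :
    dualSet (wordSet 2 u) = wordSet 2 (u.map (! ·)) := by
  ext x
  rw [dualSet, sup_wordSet, mem_wordSet_map_not, Finset.mem_symmDiff]
  by_cases hx : x = 2 + u.length
  · subst hx
    simp [last_mem_wordSet]
  · simp only [hx, false_or]
    constructor
    · rintro (⟨h1, h2⟩ | h)
      · have := le_of_mem_wordSet h1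
        have h3 : x ≤ (wordSet 2 u).sup id := Finset.le_sup (f := id) h1
        rw [sup_wordSet] at h3
        exact absurd (Finset.mem_Ico.2 ⟨this, by omega⟩) h2
      · exact h
    · exact fun h => Or.inr h

theorem rankIn_insert_self {c : ℕ} {T : Finset ℕ} (hT : ∀ x ∈ T, c < x) :
    rankIn (insert c T) c = 1 := by
  have : (insert c T).filter (fun y => y ≤ c) = {c} := by
    ext y
    simp only [Finset.mem_filter, Finset.mem_insert, Finset.mem_singleton]
    constructor
    · rintro ⟨rfl | h, h'⟩
      · rfl
      · have := hT y h; omega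
    · rintro rfl
      simp
  rw [rankIn, this, Finset.card_singleton]

theorem rankIn_insert_of_mem {c x : ℕ} {T : Finset ℕ} (hT : ∀ x ∈ T, c < x) (hx : x ∈ T) :
    rankIn (insert c T) x = rankIn T x + 1 := by
  have hc : c ∉ T := fun h => lt_irrefl _ (hT c h)
  rw [rankIn, Finset.filter_insert, if_pos (hT x hx).le, Finset.card_insert_of_notMem, rankIn]
  exact fun h => hc (Finset.mem_filter.1 h).1

theorem rankIn_singleton (c : ℕ) : rankIn {c} c = 1 := by simp [rankIn, Finset.filter_singleton]

/-- At position `c` there are `n + 1 - c` points left. Each `false` contributes one binomial and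
lowers `r`, just as the rank lowers the lower index; the final `true` contributes the last term. -/
theorem cascadeSum_wordSet (n q c : ℕ) (u : List Bool) :
    cascadeSum n q (wordSet c u) = upCount (n + 1 - c) (q - 1) (u ++ [true]) := by
  induction u generalizing q c with
  | nil =>
    simp only [cascadeSum, wordSet, Finset.sum_singleton, rankIn_singleton, List.nil_append, upCount]
    congr 1
    omega
  | cons b u ih =>
    have e : n + 1 - c - 1 = n + 1 - (c + 1) := by omega
    cases b
    · have hlt : ∀ x ∈ wordSet (c + 1) u, c < x := fun x hx => le_of_mem_wordSet hx
      simp only [List.cons_append, upCount, e]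
      rw [← ih, wordSet, cascadeSum, Finset.sum_insert (notMem_wordSet_succ c u),
        rankIn_insert_self hlt, cascadeSum]
      congr 1
      · congr 1
        omega
      · refine Finset.sum_congr rfl fun x hx => ?_
        rw [rankIn_insert_of_mem hlt hx, show q - (rankIn (wordSet (c + 1) u) x + 1) =
          q - 1 - rankIn (wordSet (c + 1) u) x by omega]
    · simp only [List.cons_append, upCount, e]
      exact ih q (c + 1)

theorem CascadeWord.lt {m r : ℕ} {u : List Bool} (h : CascadeWord m r u) : 1 ≤ r ∧ r < m := by
  induction u generalizing m r with
  | nil => exact h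
  | cons b u ih =>
    cases b
    · have := ih h; omega
    · have := ih (m := m - 1) h; omega

theorem cascadeWord_iff (n q c : ℕ) (u : List Bool) :
    CascadeWord (n + 1 - c) (q - 1) u ↔
      ∀ x ∈ wordSet c u, 1 ≤ q - rankIn (wordSet c u) x ∧ q - rankIn (wordSet c u) x ≤ n - x := by
  induction u generalizing q c with
  | nil =>
    simp only [CascadeWord, wordSet, Finset.mem_singleton, forall_eq, rankIn_singleton]
    omega
  | cons b u ih =>
    have e : n + 1 - c - 1 = n + 1 - (c + 1) := by omega
    cases b
    · have hlt : ∀ x ∈ wordSet (c + 1) u, c < x := fun x hx => le_of_mem_wordSet hx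
      have key : (∀ x ∈ wordSet (c + 1) u, 1 ≤ q - 1 - rankIn (wordSet (c + 1) u) x ∧
            q - 1 - rankIn (wordSet (c + 1) u) x ≤ n - x) ↔
          ∀ x ∈ wordSet (c + 1) u, 1 ≤ q - rankIn (wordSet c (false :: u)) x ∧
            q - rankIn (wordSet c (false :: u)) x ≤ n - x := by
        refine forall₂_congr fun x hx => ?_
        rw [wordSet, rankIn_insert_of_mem hlt hx, show q - (rankIn (wordSet (c + 1) u) x + 1) =
          q - 1 - rankIn (wordSet (c + 1) u) x by omega]
      simp only [CascadeWord, e]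
      rw [ih, key]
      constructor
      · intro h x hx
        rw [wordSet, Finset.mem_insert] at hx
        rcases hx with rfl | hx
        -- `CascadeWord` tests only the end of the word; `CascadeWord.lt` carries the inequalities
        -- back to the current position.
        · have h' := ((ih (q - 1) (x + 1)).2 (key.2 h)).lt
          rw [wordSet, rankIn_insert_self hlt]
          omega
        · exact h x hx
      · exact fun h x hx => h x (Finset.mem_insert_of_mem hx)
    · simp only [CascadeWord, e]
      exact ih q (c + 1)

theorem sparseWord_iff (c e : ℕ) (u : List Bool) :
    SparseWord c e u ↔ ∀ x ∈ wordSet c u, 2 * rankIn (wordSet c u) x + e < x := by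
  induction u generalizing c e with
  | nil => simp [SparseWord, wordSet, rankIn_singleton]
  | cons b u ih =>
    cases b
    · have hlt : ∀ x ∈ wordSet (c + 1) u, c < x := fun x hx => le_of_mem_wordSet hx
      simp only [SparseWord, wordSet]
      rw [Finset.forall_mem_insert, rankIn_insert_self hlt, ih]
      refine and_congr (by omega) (forall₂_congr fun x hx => ?_)
      rw [rankIn_insert_of_mem hlt hx]
      omega
    · exact ih (c + 1) e

/-- The relation `s + c = r + e + 1` is preserved by both letters and turns `s + 1 < r` into `2 + e
< c`. The hypothesis `m < r + s`, with `r < m`, keeps `s` positive, so the truncated `s - 1` is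
harmless. -/
theorem resWord_iff {m r s c e : ℕ} {v : List Bool} (hm : m < r + s) (hc : s + c = r + e + 1) :
    ResWord m r s v ↔ CascadeWord m r v ∧ SparseWord c e v := by
  induction v generalizing m r s c e with
  | nil => simp only [ResWord, CascadeWord, SparseWord]; omega
  | cons b v ih =>
    cases b
    · simp only [ResWord, CascadeWord, SparseWord]
      constructor
      · rintro ⟨h1, h2⟩
        obtain ⟨h3, h4⟩ := (ih (c := c + 1) (e := e + 2) (by omega) (by omega)).1 h2
        exact ⟨h3, by omega, h4⟩
      · rintro ⟨h1, h2, h3⟩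
        exact ⟨by omega, (ih (by omega) (by omega)).2 ⟨h1, h3⟩⟩
    · have aux : (r < m → (ResWord (m - 1) r (s - 1) v ↔
          CascadeWord (m - 1) r v ∧ SparseWord (c + 1) e v)) :=
        fun h => ih (by omega) (by omega)
      simp only [ResWord, CascadeWord, SparseWord]
      constructor
      · intro h
        have := h.lt
        exact (aux (by omega)).1 h
      · intro h
        have := h.1.lt
        exact (aux (by omega)).2 h

theorem CascadeWord.fits {m r : ℕ} {u : List Bool} (h : CascadeWord m r u) :
    Fits m r (u ++ [true]) := by
  induction u generalizing m r with
  | nil => simp only [CascadeWord] at h; simp only [List.nil_append, Fits]; omega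
  | cons b u ih =>
    have := h.lt
    cases b
    · exact ⟨by omega, by omega, ih h⟩
    · exact ⟨by omega, ih h⟩

theorem CascadeWord.upCount_lt {m r : ℕ} {u : List Bool} (h : CascadeWord m r u) :
    upCount m r (u ++ [true]) < m.choose r := by
  induction u generalizing m r with
  | nil =>
    have hl := h.lt
    obtain ⟨M, rfl⟩ : ∃ M, m = M + 1 := ⟨m - 1, by omega⟩
    rw [choose_succ_of_pos M hl.1]
    have : 0 < M.choose (r - 1) := Nat.choose_pos (by omega)
    simpa [upCount] using this
  | cons b u ih =>
    have hl := h.lt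
    obtain ⟨M, rfl⟩ : ∃ M, m = M + 1 := ⟨m - 1, by omega⟩
    rw [choose_succ_of_pos M hl.1]
    cases b
    · exact Nat.add_lt_add_left (ih (m := M) h) _
    · exact (ih (m := M) h).trans_le (Nat.le_add_right _ _)

/-- Uniqueness of the cascade form. Words starting with `false`, the word `[true]`, and longer words
starting with `true` count respectively more than, exactly, and less than `(m - 1).choose r`, so the
count determines the letters one by one. -/
theorem CascadeWord.eq_of_upCount_eq {m r : ℕ} {u u' : List Bool} (h : CascadeWord m r u)
    (h' : CascadeWord m r u') (e : upCount m r (u ++ [true]) = upCount m r (u' ++ [true])) :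
    u = u' := by
  induction u generalizing m r u' with
  | nil =>
    rcases u' with _ | ⟨b, u'⟩
    · rfl
    exfalso
    cases b
    · have := upCount_pos (CascadeWord.fits (m := m - 1) (r := r - 1) h')
      simp only [List.nil_append, List.cons_append, upCount] at e
      omega
    · exact (CascadeWord.upCount_lt (m := m - 1) (r := r) (u := u') h').ne' e
  | cons b u ih =>
    cases b
    · have h1 := upCount_pos (CascadeWord.fits (m := m - 1) (r := r - 1) h)
      rcases u' with _ | ⟨b', u'⟩
      · simp only [List.nil_append, List.cons_append, upCount] at e
        omega
      cases b'
      · simp only [List.cons_append, upCount] at e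
        rw [ih (m := m - 1) (r := r - 1) h h' (by omega)]
      · have h2 := CascadeWord.upCount_lt (m := m - 1) (r := r) (u := u') h'
        simp only [List.cons_append, upCount] at e
        omega
    · have h2 := CascadeWord.upCount_lt (m := m - 1) (r := r) (u := u) h
      rcases u' with _ | ⟨b', u'⟩
      · simp only [List.nil_append, List.cons_append, upCount] at e
        omega
      cases b'
      · simp only [List.cons_append, upCount] at e
        omega
      · rw [ih (m := m - 1) (r := r) h h' e]

theorem dualCount_append_true (m s : ℕ) (u : List Bool) :
    dualCount m s (u ++ [true]) = upCount m s (u.map (! ·) ++ [true]) := by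
  induction u generalizing m s with
  | nil => simp [dualCount, upCount]
  | cons b u ih => cases b <;> simp [dualCount, upCount, ih]

theorem card_wordSet (c : ℕ) (u : List Bool) : (wordSet c u).card = u.count false + 1 := by
  induction u generalizing c with
  | nil => simp [wordSet]
  | cons b u ih =>
    cases b
    · rw [wordSet, Finset.card_insert_of_notMem (notMem_wordSet_succ c u), ih]
      simp
    · rw [wordSet, ih]
      simp

/-- The final position of the walk bounds the numbers of letters. This yields the conditions `|S_γ|
≤ k` and `|T_γ| ≤ k - 1` for resistant words. -/
theorem ResWord.count_lt {m r s : ℕ} {v : List Bool} (hm : m < r + s) (h : ResWord m r s v) :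
    v.count false + s + 1 < r + v.count true ∧ r + v.count true < m := by
  have hl := h.lt
  induction v generalizing m r s with
  | nil => simp only [ResWord] at h; simp; omega
  | cons b v ih =>
    cases b
    · have := h.2.lt
      have := ih (by omega) h.2 this
      simp; omega
    · have h' : ResWord (m - 1) r (s - 1) v := h
      have := h'.lt
      have := ih (by omega) h' this
      simp; omega

/-! ### Lexicographic families and their cross-intersecting partners -/

/-- The characteristic vector of `X`, read from position `c` on, is lexicographically at least the
word `w`, or extends it. -/
def MemUp : List Bool → ℕ → Finset ℕ → Prop
  | [], _, _ => True
  | true :: w, c, X => c ∈ X ∧ MemUp w (c + 1) X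
  | false :: w, c, X => c ∈ X ∨ MemUp w (c + 1) X

/-- The condition dual to `MemUp`. -/
def MemDual : List Bool → ℕ → Finset ℕ → Prop
  | [], _, _ => False
  | true :: w, c, X => c ∈ X ∨ MemDual w (c + 1) X
  | false :: w, c, X => c ∈ X ∧ MemDual w (c + 1) X

noncomputable instance (w : List Bool) (c : ℕ) : DecidablePred (MemUp w c) :=
  fun _ => Classical.dec _

noncomputable instance (w : List Bool) (c : ℕ) : DecidablePred (MemDual w c) :=
  fun _ => Classical.dec _

theorem memUp_congr {w : List Bool} {c : ℕ} {X Y : Finset ℕ} (h : ∀ x, c ≤ x → (x ∈ X ↔ x ∈ Y)) :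
    MemUp w c X ↔ MemUp w c Y := by
  induction w generalizing c with
  | nil => exact Iff.rfl
  | cons b w ih =>
    have h1 := ih (c := c + 1) fun x hx => h x (by omega)
    cases b
    · exact or_congr (h c le_rfl) h1
    · exact and_congr (h c le_rfl) h1

theorem memDual_congr {w : List Bool} {c : ℕ} {X Y : Finset ℕ}
    (h : ∀ x, c ≤ x → (x ∈ X ↔ x ∈ Y)) : MemDual w c X ↔ MemDual w c Y := by
  induction w generalizing c with
  | nil => exact Iff.rfl
  | cons b w ih =>
    have h1 := ih (c := c + 1) fun x hx => h x (by omega)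
    cases b
    · exact and_congr (h c le_rfl) h1
    · exact or_congr (h c le_rfl) h1

theorem memUp_insert (w : List Bool) (c : ℕ) (X : Finset ℕ) :
    MemUp w (c + 1) (insert c X) ↔ MemUp w (c + 1) X :=
  memUp_congr fun x hx => by
    rw [Finset.mem_insert, or_iff_right (by omega)]

theorem memDual_insert (w : List Bool) (c : ℕ) (X : Finset ℕ) :
    MemDual w (c + 1) (insert c X) ↔ MemDual w (c + 1) X :=
  memDual_congr fun x hx => by
    rw [Finset.mem_insert, or_iff_right (by omega)]

/-- At each letter one condition forces `c` and the other allows it. Either both sets contain `c`,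
or both conditions pass to the next position; `MemDual` cannot survive to the end. -/
theorem MemUp.inter_nonempty {w : List Bool} {c : ℕ} {X Y : Finset ℕ} (h : MemUp w c X)
    (h' : MemDual w c Y) : (Y ∩ X).Nonempty := by
  induction w generalizing c with
  | nil => exact h'.elim
  | cons b w ih =>
    cases b
    · rcases h with h | h
      · exact ⟨c, Finset.mem_inter.2 ⟨h'.1, h⟩⟩
      · exact ih h h'.2
    · rcases h' with h' | h'
      · exact ⟨c, Finset.mem_inter.2 ⟨h', h.1⟩⟩
      · exact ih h.2 h'

theorem card_filter_powersetCard_insert {S : Finset ℕ} {c p : ℕ} (hc : c ∉ S)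
    (P : Finset ℕ → Prop) [DecidablePred P] :
    (((insert c S).powersetCard (p + 1)).filter P).card =
      ((S.powersetCard (p + 1)).filter P).card +
        ((S.powersetCard p).filter fun X => P (insert c X)).card := by
  rw [Finset.powersetCard_succ_insert hc, Finset.filter_union, Finset.card_union_of_disjoint,
    Finset.filter_image, Finset.card_image_of_injOn]
  · intro X hX Y hY hXY
    have hX' : c ∉ X := fun h =>
      hc ((Finset.mem_powersetCard.1 (Finset.mem_filter.1 hX).1).1 h)
    have hY' : c ∉ Y := fun h =>
      hc ((Finset.mem_powersetCard.1 (Finset.mem_filter.1 hY).1).1 h)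
    rw [← Finset.erase_insert hX', ← Finset.erase_insert hY']
    exact congrArg (fun Z => Finset.erase Z c) hXY
  · rw [Finset.disjoint_left]
    intro X hX hX'
    have h1 := (Finset.mem_powersetCard.1 (Finset.mem_filter.1 hX).1).1
    obtain ⟨Y, -, rfl⟩ := Finset.mem_image.1 (Finset.mem_filter.1 hX').1
    exact hc (h1 (Finset.mem_insert_self c Y))

theorem Ico_succ_eq_insert (c M : ℕ) :
    Finset.Ico c (c + (M + 1)) = insert c (Finset.Ico (c + 1) (c + 1 + M)) := by
  ext x
  simp only [Finset.mem_Ico, Finset.mem_insert]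
  omega

theorem card_filter_memUp {m p r c : ℕ} {w : List Bool} (hp : p + r = m) (hw : Fits m r w) :
    (((Finset.Ico c (c + m)).powersetCard p).filter (MemUp w c)).card = upCount m r w := by
  induction w generalizing m p r c with
  | nil =>
    have : ((Finset.Ico c (c + m)).powersetCard p).filter (MemUp [] c) =
        (Finset.Ico c (c + m)).powersetCard p := Finset.filter_true_of_mem fun _ _ => trivial
    rw [this, Finset.card_powersetCard, Nat.card_Ico, Nat.add_sub_cancel_left, upCount]
    exact Nat.choose_symm_of_eq_add (by omega)
  | cons b w ih =>
    obtain ⟨M, rfl⟩ : ∃ M, m = M + 1 := ⟨m - 1, by cases b <;> simp only [Fits] at hw <;> omega⟩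
    have hc : c ∉ Finset.Ico (c + 1) (c + 1 + M) := by simp
    have hc' : ∀ p, ∀ X ∈ (Finset.Ico (c + 1) (c + 1 + M)).powersetCard p, c ∉ X :=
      fun p X hX h => hc ((Finset.mem_powersetCard.1 hX).1 h)
    rw [Ico_succ_eq_insert]
    cases b
    · obtain ⟨h1, h2, h3⟩ := hw
      have hfirst : ∀ p, ((Finset.Ico (c + 1) (c + 1 + M)).powersetCard p).filter
          (MemUp (false :: w) c) =
          ((Finset.Ico (c + 1) (c + 1 + M)).powersetCard p).filter (MemUp w (c + 1)) := by
        intro p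
        refine Finset.filter_congr fun X hX => ?_
        exact or_iff_right (hc' p X hX)
      simp only [upCount, Nat.add_sub_cancel] at h3 ⊢
      rcases p with _ | p
      · have hE : (insert c (Finset.Ico (c + 1) (c + 1 + M))).powersetCard 0 =
            (Finset.Ico (c + 1) (c + 1 + M)).powersetCard 0 := by simp
        rw [hE, hfirst, ih (m := M) (r := r - 1) (by omega) h3,
          Nat.choose_eq_zero_of_lt (by omega), zero_add]
      · rw [card_filter_powersetCard_insert hc, hfirst,
          ih (m := M) (r := r - 1) (by omega) h3, add_comm, Finset.filter_true_of_mem,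
          Finset.card_powersetCard, Nat.card_Ico, Nat.add_sub_cancel_left,
          Nat.choose_symm_of_eq_add (n := M) (a := p) (b := r) (by omega)]
        exact fun X _ => Or.inl (Finset.mem_insert_self c X)
    · obtain ⟨h1, h2⟩ := hw
      simp only [upCount, Nat.add_sub_cancel] at h2 ⊢
      obtain ⟨p, rfl⟩ : ∃ p', p = p' + 1 := ⟨p - 1, by omega⟩
      rw [card_filter_powersetCard_insert hc, Finset.filter_false_of_mem, Finset.card_empty,
        zero_add, ← ih (m := M) (p := p) (c := c + 1) (by omega) h2]
      · congr 1
        refine Finset.filter_congr fun X _ => ?_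
        exact (and_iff_right (Finset.mem_insert_self c X)).trans (memUp_insert w c X)
      · exact fun X hX h => hc' _ X hX h.1

theorem dualCount_eq_zero {m r s : ℕ} {w : List Bool} (hw : Fits m r w) (h : m < s) :
    dualCount m s w = 0 := by
  induction w generalizing m r s with
  | nil => rfl
  | cons b w ih =>
    cases b
    · exact ih hw.2.2 (by omega)
    · have := hw.1
      rw [dualCount, Nat.choose_eq_zero_of_lt (by omega), ih hw.2 (by omega)]

theorem card_filter_memDual {m q r s c : ℕ} {w : List Bool} (hq : q + s = m) (hm : m ≤ r + s)
    (hw : Fits m r w) :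
    (((Finset.Ico c (c + m)).powersetCard q).filter (MemDual w c)).card = dualCount m s w := by
  induction w generalizing m q r s c with
  | nil =>
    have : ((Finset.Ico c (c + m)).powersetCard q).filter (MemDual [] c) = ∅ :=
      Finset.filter_false_of_mem fun _ _ h => h
    rw [this]
    rfl
  | cons b w ih =>
    obtain ⟨M, rfl⟩ : ∃ M, m = M + 1 := ⟨m - 1, by cases b <;> simp only [Fits] at hw <;> omega⟩
    have hc : c ∉ Finset.Ico (c + 1) (c + 1 + M) := by simp
    have hc' : ∀ q, ∀ X ∈ (Finset.Ico (c + 1) (c + 1 + M)).powersetCard q, c ∉ X :=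
      fun q X hX h => hc ((Finset.mem_powersetCard.1 hX).1 h)
    have hE : (insert c (Finset.Ico (c + 1) (c + 1 + M))).powersetCard 0 =
        (Finset.Ico (c + 1) (c + 1 + M)).powersetCard 0 := by simp
    rw [Ico_succ_eq_insert]
    cases b
    · obtain ⟨h1, h2, h3⟩ := hw
      have hfirst : ∀ q, ((Finset.Ico (c + 1) (c + 1 + M)).powersetCard q).filter
          (MemDual (false :: w) c) = ∅ :=
        fun q => Finset.filter_false_of_mem fun X hX h => hc' q X hX h.1
      simp only [dualCount, Nat.add_sub_cancel] at h3 ⊢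
      rcases q with _ | q
      -- For `q = 0` the complement size `s = M + 1` exceeds the number of remaining points, so the
      -- count vanishes.
      · rw [hE, hfirst, dualCount_eq_zero h3 (by omega), Finset.card_empty]
      · rw [card_filter_powersetCard_insert hc, hfirst, Finset.card_empty, zero_add,
          ← ih (m := M) (q := q) (r := r - 1) (c := c + 1) (by omega) (by omega) h3]
        congr 1
        refine Finset.filter_congr fun X _ => ?_
        exact (and_iff_right (Finset.mem_insert_self c X)).trans (memDual_insert w c X)
    · obtain ⟨h1, h2⟩ := hw
      have hfirst : ∀ q, ((Finset.Ico (c + 1) (c + 1 + M)).powersetCard q).filter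
          (MemDual (true :: w) c) =
          ((Finset.Ico (c + 1) (c + 1 + M)).powersetCard q).filter (MemDual w (c + 1)) := by
        intro q
        refine Finset.filter_congr fun X hX => ?_
        exact or_iff_right (hc' q X hX)
      simp only [dualCount, Nat.add_sub_cancel] at h2 ⊢
      rcases q with _ | q
      · rw [hE, hfirst, ih (m := M) (s := s - 1) (by omega) (by omega) h2,
          Nat.choose_eq_zero_of_lt (by omega), zero_add]
      · rw [card_filter_powersetCard_insert hc, hfirst,
          ih (m := M) (s := s - 1) (by omega) (by omega) h2, add_comm, Finset.filter_true_of_mem,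
          Finset.card_powersetCard, Nat.card_Ico, Nat.add_sub_cancel_left,
          Nat.choose_symm_of_eq_add (n := M) (a := q) (b := s) (by omega)]
        exact fun X _ => Or.inl (Finset.mem_insert_self c X)

theorem exists_subset_disjoint {S A : Finset ℕ} {p : ℕ} (h : p + A.card ≤ S.card) :
    ∃ B ∈ S.powersetCard p, ¬ (A ∩ B).Nonempty := by
  have h1 := Finset.le_card_sdiff A S
  obtain ⟨B, hB, hBc⟩ := Finset.exists_subset_card_eq (s := S \ A) (n := p) (by omega)
  refine ⟨B, Finset.mem_powersetCard.2 ⟨hB.trans Finset.sdiff_subset, hBc⟩, ?_⟩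
  rintro ⟨x, hx⟩
  rw [Finset.mem_inter] at hx
  exact (Finset.mem_sdiff.1 (hB hx.2)).2 hx.1

/-- The converse of `MemUp.inter_nonempty`, so `MemDual` describes exactly the sets meeting the
whole segment. Since `p + A.card ≤ m`, there is room to build a member of the segment avoiding `A`
whenever a forced point is missing from `A`. -/
theorem memDual_of_forall {m p r c : ℕ} {w : List Bool} {A : Finset ℕ} (hp : p + r = m)
    (hA : p + A.card ≤ m) (hAs : A ⊆ Finset.Ico c (c + m)) (hw : Fits m r w)
    (h : ∀ B ∈ (Finset.Ico c (c + m)).powersetCard p, MemUp w c B → (A ∩ B).Nonempty) :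
    MemDual w c A := by
  induction w generalizing m p r c A with
  | nil =>
    obtain ⟨B, hB, hAB⟩ := exists_subset_disjoint (S := Finset.Ico c (c + m)) (A := A) (p := p)
      (by simpa using hA)
    exact absurd (h B hB trivial) hAB
  | cons b w ih =>
    obtain ⟨M, rfl⟩ : ∃ M, m = M + 1 := ⟨m - 1, by cases b <;> simp only [Fits] at hw <;> omega⟩
    have hc : c ∉ Finset.Ico (c + 1) (c + 1 + M) := by simp
    -- For `p = 0` the segment would contain the empty set, which meets nothing.
    have hp0 : 1 ≤ p := by
      by_contra hp0
      obtain rfl : p = 0 := by omega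
      have := upCount_pos hw
      rw [← card_filter_memUp (c := c) hp hw, Finset.card_pos] at this
      obtain ⟨B, hB⟩ := this
      rw [Finset.mem_filter] at hB
      have h2 := h B hB.1 hB.2
      simp only [Finset.powersetCard_zero, Finset.mem_singleton] at hB
      rw [hB.1, Finset.inter_empty] at h2
      exact Finset.not_nonempty_empty h2
    obtain ⟨p, rfl⟩ : ∃ p', p = p' + 1 := ⟨p - 1, by omega⟩
    rw [Ico_succ_eq_insert] at h hAs
    have hins : ∀ {B}, B ∈ (Finset.Ico (c + 1) (c + 1 + M)).powersetCard p →
        insert c B ∈ (insert c (Finset.Ico (c + 1) (c + 1 + M))).powersetCard (p + 1) := by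
      intro B hB
      rw [Finset.mem_powersetCard] at hB ⊢
      exact ⟨Finset.insert_subset_insert _ hB.1,
        by rw [Finset.card_insert_of_notMem fun h => hc (hB.1 h), hB.2]⟩
    cases b
    · obtain ⟨h1, h2, h3⟩ := hw
      have hcA : c ∈ A := by
        by_contra hcA
        have hA' : A ⊆ Finset.Ico (c + 1) (c + 1 + M) := fun x hx =>
          (Finset.mem_insert.1 (hAs hx)).resolve_left fun h => hcA (h ▸ hx)
        obtain ⟨B, hB, hAB⟩ := exists_subset_disjoint (S := Finset.Ico (c + 1) (c + 1 + M))
          (A := A) (p := p) (by simp; omega)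
        have := h _ (hins hB) (Or.inl (Finset.mem_insert_self c B))
        rw [Finset.inter_insert_of_notMem hcA] at this
        exact hAB this
      have hcard := Finset.card_erase_add_one hcA
      refine ⟨hcA, ?_⟩
      have := ih (m := M) (p := p + 1) (r := r - 1) (c := c + 1) (A := A.erase c) (by omega)
        (by omega) (Finset.subset_insert_iff.1 hAs) h3 ?_
      · exact (memDual_congr fun x hx => by
          rw [Finset.mem_erase, and_iff_right (by omega)]).1 this
      · intro B hB hBw
        rw [Finset.mem_powersetCard] at hB
        obtain ⟨x, hx⟩ := h B (Finset.mem_powersetCard.2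
          ⟨hB.1.trans (Finset.subset_insert _ _), hB.2⟩) (Or.inr hBw)
        rw [Finset.mem_inter] at hx
        exact ⟨x, Finset.mem_inter.2 ⟨Finset.mem_erase.2
          ⟨fun h => hc (h ▸ hB.1 hx.2), hx.1⟩, hx.2⟩⟩
    · obtain ⟨h1, h2⟩ := hw
      by_cases hcA : c ∈ A
      · exact Or.inl hcA
      · have hA' : A ⊆ Finset.Ico (c + 1) (c + 1 + M) := fun x hx =>
          (Finset.mem_insert.1 (hAs hx)).resolve_left fun h => hcA (h ▸ hx)
        refine Or.inr (ih (m := M) (p := p) (by omega) (by omega) hA' h2 fun B hB hBw => ?_)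
        have := h _ (hins hB) ⟨Finset.mem_insert_self c B, (memUp_insert w c B).2 hBw⟩
        rwa [Finset.inter_insert_of_notMem hcA] at this

/-! ### Kruskal-Katona for cross-intersecting pairs -/

theorem MemUp.of_first_diff {w : List Bool} {c a : ℕ} {X Y : Finset ℕ} (h : MemUp w c X)
    (hca : c ≤ a) (haX : a ∉ X) (haY : a ∈ Y) (hXY : ∀ x < a, x ∈ X → x ∈ Y) : MemUp w c Y := by
  induction w generalizing c with
  | nil => trivial
  | cons b w ih =>
    rcases hca.eq_or_lt with rfl | hlt
    · cases b
      · exact Or.inl haY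
      · exact absurd h.1 haX
    · cases b
      · exact h.imp (hXY c hlt) fun h => ih h hlt
      · exact ⟨hXY c hlt h.1, ih h.2 hlt⟩

/-- The embedding of `Fin N` in `ℕ` which reverses the order. -/
def revEmb (N : ℕ) : Fin N ↪ ℕ := Fin.revPerm.toEmbedding.trans Fin.valEmbedding

theorem revEmb_apply {N : ℕ} (j : Fin N) : revEmb N j = N - (j + 1) := by
  simp [revEmb]

theorem map_revEmb_subset {N : ℕ} (X : Finset (Fin N)) :
    X.map (revEmb N) ⊆ Finset.Ico 0 (0 + N) := by
  intro x hx
  obtain ⟨j, -, rfl⟩ := Finset.mem_map.1 hx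
  rw [revEmb_apply, Finset.mem_Ico]
  omega

theorem exists_map_revEmb_eq {N : ℕ} {B : Finset ℕ} (hB : B ⊆ Finset.Ico 0 (0 + N)) :
    ∃ X : Finset (Fin N), X.map (revEmb N) = B := by
  refine ⟨Finset.univ.filter fun j => revEmb N j ∈ B, ?_⟩
  ext x
  simp only [Finset.mem_map, Finset.mem_filter, Finset.mem_univ, true_and]
  constructor
  · rintro ⟨j, hj, rfl⟩
    exact hj
  · intro hx
    have := Finset.mem_Ico.1 (hB hx)
    have e : revEmb N ⟨N - (x + 1), by omega⟩ = x := by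
      rw [revEmb_apply]
      simp only
      omega
    exact ⟨⟨N - (x + 1), by omega⟩, by rwa [e], e⟩

-- Colex compares sets at their largest difference. Complementation exchanges which set contains
-- that point, and reversing the order makes it the first difference, so colex initial segments of
-- complements become upward closed lexicographic families.
open Finset in
theorem isInitSeg_memUp (N r : ℕ) (w : List Bool) :
    Finset.Colex.IsInitSeg ((univ : Finset (Finset (Fin N))).filter fun C =>
      C.card = r ∧ MemUp w 0 (Cᶜ.map (revEmb N))) r := by
  refine ⟨fun C hC => ?_, fun s t hs ⟨hlt, ht⟩ => ?_⟩
  · exact (mem_filter.1 (mem_coe.1 hC)).2.1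
  · obtain ⟨a, has, hat, hab⟩ := Finset.Colex.toColex_lt_toColex_iff_exists_forall_lt.1 hlt
    refine mem_filter.2 ⟨mem_univ _, ht, ?_⟩
    refine (mem_filter.1 hs).2.2.of_first_diff (a := revEmb N a) (Nat.zero_le _) ?_ ?_ ?_
    · simpa using has
    · simpa using hat
    · intro x hx hxs
      obtain ⟨b, hb, rfl⟩ := mem_map.1 hxs
      rw [mem_map' , mem_compl] at *
      intro hbt
      have := hab b hbt hb
      rw [revEmb_apply, revEmb_apply] at hx
      have := Fin.lt_def.1 this
      omega

open Finset in
open scoped FinsetFamily in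
/-- A consequence of the Kruskal-Katona theorem: the sizes of cross-intersecting families. -/
theorem card_le_dualCount {N p q r s : ℕ} {w : List Bool} {𝒜 ℬ : Finset (Finset (Fin N))}
    (hp : p + r = N) (hq : q + s = N) (h : N ≤ r + s) (h𝒜 : ∀ A ∈ 𝒜, A.card = q)
    (hℬ : ∀ B ∈ ℬ, B.card = p) (hcross : ∀ A ∈ 𝒜, ∀ B ∈ ℬ, (A ∩ B).Nonempty) (hw : Fits N r w)
    (hc : upCount N r w ≤ ℬ.card) : 𝒜.card ≤ dualCount N s w := by
  -- A set meets every `B` exactly when it lies in no complement of a `B`, that is, when it avoids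
  -- the iterated shadow of `𝒞`. The initial segment `𝒟` minimizes this shadow.
  set 𝒞 : Finset (Finset (Fin N)) := ℬᶜˢ with h𝒞
  set 𝒟 : Finset (Finset (Fin N)) := univ.filter fun C =>
    C.card = r ∧ MemUp w 0 (Cᶜ.map (revEmb N)) with h𝒟
  have h𝒞s : (𝒞 : Set (Finset (Fin N))).Sized r := by
    intro C hC
    have := hℬ _ (mem_compls.1 (mem_coe.1 hC))
    rw [card_compl, Fintype.card_fin] at this
    have := card_finset_fin_le C
    omega
  have hinit : Finset.Colex.IsInitSeg 𝒟 r := isInitSeg_memUp N r w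
  have h𝒟c : 𝒟.card ≤ 𝒞.card := by
    rw [h𝒞, card_compls]
    refine le_trans ?_ hc
    rw [← card_filter_memUp (c := 0) hp hw]
    refine card_le_card_of_injOn (fun C => Cᶜ.map (revEmb N)) ?_ ?_
    · intro C hC
      have hC := (mem_filter.1 (mem_coe.1 hC)).2
      refine mem_coe.2 (mem_filter.2 ⟨mem_powersetCard.2 ⟨map_revEmb_subset _, ?_⟩, hC.2⟩)
      rw [card_map, card_compl, Fintype.card_fin]
      omega
    · intro C _ C' _ hCC
      exact compl_injective (map_injective _ hCC)
  have hkk := iterated_kk (k := r - q) h𝒞s h𝒟c hinit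
  have hshadow : ∀ {ℱ : Finset (Finset (Fin N))}, (ℱ : Set (Finset (Fin N))).Sized r →
      ∂^[r - q] ℱ ⊆ powersetCard q univ := by
    intro ℱ hℱ X hX
    have := (hℱ.shadow_iterate (k := r - q)) (mem_coe.2 hX)
    exact mem_powersetCard.2 ⟨subset_univ _, by omega⟩
  have h1 : 𝒜 ⊆ powersetCard q univ \ ∂^[r - q] 𝒞 := by
    intro A hA
    refine mem_sdiff.2 ⟨mem_powersetCard.2 ⟨subset_univ _, h𝒜 A hA⟩, fun hA' => ?_⟩
    obtain ⟨C, hC, hAC, -⟩ := mem_shadow_iterate_iff_exists_sdiff.1 hA'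
    obtain ⟨x, hx⟩ := hcross A hA _ (mem_compls.1 hC)
    rw [mem_inter, mem_compl] at hx
    exact hx.2 (hAC hx.1)
  -- Sets outside the shadow of `𝒟` meet the whole segment of `w`, so they satisfy `MemDual`.
  have h2 : (powersetCard q univ \ ∂^[r - q] 𝒟).card ≤ dualCount N s w := by
    rw [← card_filter_memDual (c := 0) hq h hw]
    refine card_le_card_of_injOn (fun A => A.map (revEmb N)) ?_ (map_injective _).injOn
    intro A hA
    obtain ⟨hA1, hA2⟩ := mem_sdiff.1 (mem_coe.1 hA)
    have hAq := (mem_powersetCard.1 hA1).2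
    refine mem_coe.2 (mem_filter.2 ⟨mem_powersetCard.2 ⟨map_revEmb_subset _, ?_⟩, ?_⟩)
    · rw [card_map, hAq]
    refine memDual_of_forall hp (by rw [card_map]; omega) (map_revEmb_subset _) hw ?_
    intro B hB hBw
    rw [mem_powersetCard] at hB
    obtain ⟨X, rfl⟩ := exists_map_revEmb_eq hB.1
    rw [card_map] at hB
    have hXr : Xᶜ.card = r := by
      rw [card_compl, Fintype.card_fin]
      omega
    have hX : Xᶜ ∈ 𝒟 := mem_filter.2 ⟨mem_univ _, hXr, by rwa [compl_compl]⟩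
    by_contra hne
    refine hA2 (mem_shadow_iterate_iff_exists_sdiff.2 ⟨Xᶜ, hX, ?_, ?_⟩)
    · intro x hx
      rw [mem_compl]
      intro hx'
      exact hne ⟨_, mem_inter.2 ⟨mem_map_of_mem _ hx, mem_map_of_mem _ hx'⟩⟩
    · have : A ⊆ Xᶜ := by
        intro x hx
        rw [mem_compl]
        intro hx'
        exact hne ⟨_, mem_inter.2 ⟨mem_map_of_mem _ hx, mem_map_of_mem _ hx'⟩⟩
      rw [card_sdiff_of_subset this, hXr, hAq]
  have h3 := card_le_card h1
  rw [card_sdiff_of_subset (hshadow h𝒞s)] at h3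
  rw [card_sdiff_of_subset (hshadow hinit.1)] at h2
  omega

/-! ### From pairs to intersecting families and back -/

open Finset in
/-- An intersecting family whose diversity is counted by `w` is at most as large as the pair of
families given by `w`. -/
theorem card_le_pairCount {n k : ℕ} {w : List Bool} {F : Finset (Finset ℕ)} (hk : 1 ≤ k)
    (hn : 2 * k < n) (hF : IsIntersectingFamily n k F) (hw : Fits (n - 1) (n - 1 - k) w)
    (hd : upCount (n - 1) (n - 1 - k) w = diversity n F) :
    F.card ≤ pairCount (n - 1) (n - 1 - k) (n - k) w := by
  obtain ⟨i, hi, hsup⟩ := exists_mem_eq_sup (Icc 1 n) ⟨1, by simp; omega⟩ (degreeIn F)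
  have hcard : ((Icc 1 n).erase i).card = n - 1 := by
    rw [card_erase_of_mem hi, Nat.card_Icc, Nat.add_sub_cancel]
  -- Relabels the points other than the most popular `i`. Only bijectivity matters; the order plays
  -- no role in cross-intersection.
  let σ : Fin (n - 1) ↪ ℕ := (((Icc 1 n).erase i).orderEmbOfFin hcard).toEmbedding
  have hσ : ∀ x, x ∈ (Icc 1 n).erase i → ∃ j, σ j = x := by
    intro x hx
    have : x ∈ Set.range (((Icc 1 n).erase i).orderEmbOfFin hcard) := by
      rw [range_orderEmbOfFin]
      exact hx
    exact this
  have hσ' : ∀ j, σ j ∈ (Icc 1 n).erase i := fun j => orderEmbOfFin_mem _ hcard j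
  let φ : Finset ℕ → Finset (Fin (n - 1)) := fun X => univ.filter fun j => σ j ∈ X
  have hφ : ∀ X ∈ F, (φ X).map σ = X.erase i := by
    intro X hX
    have hXn := (mem_powersetCard.1 (hF.1 hX)).1
    ext x
    simp only [φ, mem_map, mem_filter, mem_univ, true_and, mem_erase]
    constructor
    · rintro ⟨j, hj, rfl⟩
      exact ⟨(mem_erase.1 (hσ' j)).1, hj⟩
    · rintro ⟨hxi, hx⟩
      obtain ⟨j, rfl⟩ := hσ x (mem_erase.2 ⟨hxi, hXn hx⟩)
      exact ⟨j, hx, rfl⟩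
  have hinj1 : Set.InjOn φ (F.filter fun A => i ∈ A) := by
    intro X hX Y hY hXY
    rw [mem_coe, mem_filter] at hX hY
    rw [← insert_erase hX.2, ← insert_erase hY.2, ← hφ X hX.1, ← hφ Y hY.1, hXY]
  have hinj2 : Set.InjOn φ (F.filter fun A => i ∉ A) := by
    intro X hX Y hY hXY
    rw [mem_coe, mem_filter] at hX hY
    rw [← erase_eq_of_notMem hX.2, ← erase_eq_of_notMem hY.2, ← hφ X hX.1, ← hφ Y hY.1, hXY]
  have hsplit : (F.filter fun A => i ∈ A).card + (F.filter fun A => i ∉ A).card = F.card :=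
    card_filter_add_card_filter_not _
  have hdiv : diversity n F = (F.filter fun A => i ∉ A).card := by
    rw [diversity, hsup, degreeIn]
    omega
  have key := card_le_dualCount (N := n - 1) (p := k) (q := k - 1) (r := n - 1 - k) (s := n - k)
    (w := w) (𝒜 := (F.filter fun A => i ∈ A).image φ) (ℬ := (F.filter fun A => i ∉ A).image φ)
    (by omega) (by omega) (by omega) ?_ ?_ ?_ hw ?_
  · rw [card_image_of_injOn hinj1] at key
    rw [pairCount]
    omega
  · intro A hA
    obtain ⟨X, hX, rfl⟩ := mem_image.1 hA
    rw [mem_filter] at hX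
    rw [← card_map σ, hφ X hX.1, card_erase_of_mem hX.2, (mem_powersetCard.1 (hF.1 hX.1)).2]
  · intro A hA
    obtain ⟨X, hX, rfl⟩ := mem_image.1 hA
    rw [mem_filter] at hX
    rw [← card_map σ, hφ X hX.1, erase_eq_of_notMem hX.2, (mem_powersetCard.1 (hF.1 hX.1)).2]
  · intro A hA B hB
    obtain ⟨X, hX, rfl⟩ := mem_image.1 hA
    obtain ⟨Y, hY, rfl⟩ := mem_image.1 hB
    rw [mem_filter] at hX hY
    obtain ⟨x, hx⟩ := hF.2 X hX.1 Y hY.1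
    rw [mem_inter] at hx
    obtain ⟨j, rfl⟩ := hσ x (mem_erase.2 ⟨fun h => hY.2 (h ▸ hx.2),
      (mem_powersetCard.1 (hF.1 hX.1)).1 hx.1⟩)
    exact ⟨j, by simpa [φ] using hx⟩
  · rw [card_image_of_injOn hinj2]
    omega

open Finset in
/-- The pair of families given by `w` yields an intersecting family. -/
theorem exists_family {n k : ℕ} {w : List Bool} (hk : 3 ≤ k) (hn : 2 * k < n)
    (hw : Fits (n - 1) (n - 1 - k) (true :: true :: w))
    (hle : upCount (n - 1) (n - 1 - k) (true :: true :: w) ≤ (n - 4).choose (k - 3)) :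
    ∃ F, IsIntersectingFamily n k F ∧
      diversity n F = upCount (n - 1) (n - 1 - k) (true :: true :: w) ∧
      F.card = pairCount (n - 1) (n - 1 - k) (n - k) (true :: true :: w) := by
  set u := true :: true :: w with hu
  have hI : Ico 2 (2 + (n - 1)) = Icc 2 n := by ext x; simp; omega
  set B := ((Ico 2 (2 + (n - 1))).powersetCard k).filter (MemUp u 2) with hB
  set A := ((Ico 2 (2 + (n - 1))).powersetCard (k - 1)).filter (MemDual u 2) with hA
  have hBc : B.card = upCount (n - 1) (n - 1 - k) u := card_filter_memUp (by omega) hw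
  have hAc : A.card = dualCount (n - 1) (n - k) u :=
    card_filter_memDual (by omega) (by omega) hw
  have hB1 : ∀ X ∈ B, 1 ∉ X := fun X hX h => by
    have := (mem_powersetCard.1 (mem_filter.1 hX).1).1 h
    simp at this
  have hA1 : ∀ X ∈ A, 1 ∉ X := fun X hX h => by
    have := (mem_powersetCard.1 (mem_filter.1 hX).1).1 h
    simp at this
  have hAi : (A.image (insert 1)).card = A.card := by
    refine card_image_of_injOn fun X hX Y hY hXY => ?_
    rw [← erase_insert (hA1 X hX), ← erase_insert (hA1 Y hY)]
    exact congrArg (fun Z => Finset.erase Z 1) hXY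
  set F := B ∪ A.image (insert 1) with hF
  have hF1 : F.filter (fun X => 1 ∈ X) = A.image (insert 1) := by
    rw [hF, filter_union, filter_false_of_mem hB1, empty_union, filter_true_of_mem]
    intro X hX
    obtain ⟨Y, -, rfl⟩ := mem_image.1 hX
    exact mem_insert_self 1 Y
  have hF2 : F.filter (fun X => 1 ∉ X) = B := by
    rw [hF, filter_union, filter_true_of_mem hB1, filter_false_of_mem, union_empty]
    intro X hX
    obtain ⟨Y, -, rfl⟩ := mem_image.1 hX
    exact not_not.2 (mem_insert_self 1 Y)
  have hsplit : (F.filter fun X => 1 ∈ X).card + (F.filter fun X => 1 ∉ X).card = F.card :=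
    card_filter_add_card_filter_not _
  have hFk : F ⊆ (Icc 1 n).powersetCard k := by
    intro X hX
    rcases mem_union.1 hX with hX | hX
    · have := mem_powersetCard.1 (mem_filter.1 hX).1
      rw [hI] at this
      exact mem_powersetCard.2 ⟨this.1.trans (Icc_subset_Icc_left (by omega)), this.2⟩
    · obtain ⟨Y, hY, rfl⟩ := mem_image.1 hX
      have := mem_powersetCard.1 (mem_filter.1 hY).1
      rw [hI] at this
      refine mem_powersetCard.2 ⟨insert_subset (by simp; omega)
        (this.1.trans (Icc_subset_Icc_left (by omega))), ?_⟩
      rw [card_insert_of_notMem (hA1 Y hY), this.2]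
      omega
  -- To see that `1` has maximal degree, compare the members containing exactly one of `1` and `i`.
  -- Those with `i` only lie in `B`, hence number at most `(n - 4).choose (k - 3)`.
  have hdeg : ∀ i ∈ Icc 1 n, degreeIn F i ≤ degreeIn F 1 := by
    intro i hi
    rw [mem_Icc] at hi
    rcases hi.1.eq_or_lt with rfl | hi1
    · rfl
    -- As the word starts with two letters `true`, every `k`-set containing `1` and one of `2`, `3`
    -- belongs to `F`. A choice of `j ≠ i` among these leaves `(n - 3).choose (k - 2)` members that
    -- contain `1` but not `i`.
    obtain ⟨j, hj, hji⟩ : ∃ j, (j = 2 ∨ j = 3) ∧ j ≠ i := by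
      by_cases h : i = 2
      · exact ⟨3, Or.inr rfl, by omega⟩
      · exact ⟨2, Or.inl rfl, fun h' => h h'.symm⟩
    have e1 : (F.filter fun X => i ∈ X).card = ((F.filter fun X => i ∈ X).filter (1 ∈ ·)).card +
        ((F.filter fun X => i ∈ X).filter (1 ∉ ·)).card :=
      (card_filter_add_card_filter_not _).symm
    have e2 : (F.filter fun X => 1 ∈ X).card = ((F.filter fun X => 1 ∈ X).filter (i ∈ ·)).card +
        ((F.filter fun X => 1 ∈ X).filter (i ∉ ·)).card :=
      (card_filter_add_card_filter_not _).symm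
    have e3 : ((F.filter fun X => i ∈ X).filter (1 ∈ ·)) =
        ((F.filter fun X => 1 ∈ X).filter (i ∈ ·)) := filter_comm _ _ _
    have e4 : ((F.filter fun X => i ∈ X).filter (1 ∉ ·)).card ≤ B.card := by
      rw [← hF2, filter_comm]
      exact card_filter_le _ _
    have e5 : (n - 3).choose (k - 2) ≤ ((F.filter fun X => 1 ∈ X).filter (i ∉ ·)).card := by
      have hc : (((Icc 2 n).erase i).erase j).card = n - 3 := by
        rw [card_erase_of_mem, card_erase_of_mem, Nat.card_Icc]
        · omega
        · rw [mem_Icc]; omega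
        · rw [mem_erase, mem_Icc]
          exact ⟨hji, by omega⟩
      rw [hF1, ← hc, ← card_powersetCard]
      have hX : ∀ X ∈ (((Icc 2 n).erase i).erase j).powersetCard (k - 2),
          X ⊆ Icc 2 n ∧ i ∉ X ∧ j ∉ X ∧ 1 ∉ X ∧ X.card = k - 2 := by
        intro X hX
        rw [mem_powersetCard] at hX
        refine ⟨hX.1.trans ((erase_subset _ _).trans (erase_subset _ _)), fun h => ?_, fun h => ?_,
          fun h => ?_, hX.2⟩ <;> simpa using hX.1 h
      refine card_le_card_of_injOn (fun X => insert 1 (insert j X)) ?_ ?_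
      · intro X hXm
        obtain ⟨h1, h2, h3, h4, h5⟩ := hX X hXm
        refine mem_coe.2 (mem_filter.2 ⟨mem_image_of_mem _ (mem_filter.2
          ⟨mem_powersetCard.2 ⟨?_, ?_⟩, ?_⟩), ?_⟩)
        · rw [hI]
          exact insert_subset (by rw [mem_Icc]; omega) h1
        · rw [card_insert_of_notMem h3]
          omega
        · rcases hj with rfl | rfl
          · exact Or.inl (mem_insert_self _ _)
          · exact Or.inr (Or.inl (mem_insert_self _ _))
        · rw [mem_insert, mem_insert, not_or, not_or]
          exact ⟨by omega, fun h => hji h.symm, h2⟩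
      · intro X hXm Y hYm hXY
        obtain ⟨-, -, h3, h4, -⟩ := hX X hXm
        obtain ⟨-, -, h3', h4', -⟩ := hX Y hYm
        have h1 : 1 ∉ insert j X := by
          rw [mem_insert, not_or]; exact ⟨by omega, h4⟩
        have h1' : 1 ∉ insert j Y := by
          rw [mem_insert, not_or]; exact ⟨by omega, h4'⟩
        have h := congrArg (fun Z => (Finset.erase Z 1).erase j) hXY
        simpa only [erase_insert h1, erase_insert h1', erase_insert h3, erase_insert h3'] using h
    have e6 : (n - 4).choose (k - 3) ≤ (n - 3).choose (k - 2) := by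
      have := Nat.choose_succ_succ' (n - 4) (k - 3)
      rw [show n - 4 + 1 = n - 3 by omega, show k - 3 + 1 = k - 2 by omega] at this
      omega
    rw [degreeIn, degreeIn, e1, e2, e3]
    omega
  refine ⟨F, ⟨hFk, ?_⟩, ?_, ?_⟩
  · intro X hX Y hY
    rcases mem_union.1 hX with hX | hX <;> rcases mem_union.1 hY with hY | hY
    · exact ⟨2, mem_inter.2 ⟨(mem_filter.1 hX).2.1, (mem_filter.1 hY).2.1⟩⟩
    · obtain ⟨Z, hZ, rfl⟩ := mem_image.1 hY
      rw [inter_comm]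
      exact ((mem_filter.1 hX).2.inter_nonempty (mem_filter.1 hZ).2).mono
        (inter_subset_inter_right (subset_insert _ _))
    · obtain ⟨Z, hZ, rfl⟩ := mem_image.1 hX
      exact ((mem_filter.1 hY).2.inter_nonempty (mem_filter.1 hZ).2).mono
        (inter_subset_inter_right (subset_insert _ _))
    · obtain ⟨Z, hZ, rfl⟩ := mem_image.1 hX
      obtain ⟨Z', hZ', rfl⟩ := mem_image.1 hY
      exact ⟨1, mem_inter.2 ⟨mem_insert_self _ _, mem_insert_self _ _⟩⟩
  · have hsup : (Icc 1 n).sup (degreeIn F) = degreeIn F 1 :=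
      le_antisymm (Finset.sup_le hdeg) (le_sup (f := degreeIn F) (by simp; omega))
    rw [diversity, hsup, degreeIn, ← hBc, ← hF2]
    omega
  · rw [pairCount, ← hsplit, hF1, hF2, hAi, hAc, hBc, add_comm]

/-! ### Resistant numbers as words, and the assembly -/

theorem isCascadeSet_wordSet_iff {n k g : ℕ} {u : List Bool} :
    IsCascadeSet n k g (wordSet 2 u) ↔ CascadeWord (n - 1) (n - 1 - k) u ∧
      g = upCount (n - 1) (n - 1 - k) (u ++ [true]) := by
  have h1 := cascadeWord_iff n (n - k) 2 u
  have h2 := cascadeSum_wordSet n (n - k) 2 u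
  rw [show n + 1 - 2 = n - 1 by omega, show n - k - 1 = n - 1 - k by omega] at h1 h2
  rw [IsCascadeSet, h1, h2]
  refine and_congr_left fun _ => forall₂_congr fun x hx => and_iff_right ?_
  have := le_of_mem_wordSet hx
  omega

theorem IsCascadeSet.exists_word {n k g : ℕ} {T : Finset ℕ} (h : IsCascadeSet n k g T)
    (hT : T.Nonempty) : ∃ u, T = wordSet 2 u := exists_wordSet_eq hT fun x hx => (h.1 x hx).1

theorem isCascadeSet_empty_iff {n k g : ℕ} : IsCascadeSet n k g ∅ ↔ g = 0 := by
  simp [IsCascadeSet, cascadeSum]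

theorem IsCascadeSet.nonempty_iff {n k g : ℕ} {T : Finset ℕ} (h : IsCascadeSet n k g T) :
    T.Nonempty ↔ 0 < g := by
  constructor
  · intro hT
    obtain ⟨u, rfl⟩ := h.exists_word hT
    obtain ⟨h1, rfl⟩ := isCascadeSet_wordSet_iff.1 h
    exact upCount_pos h1.fits
  · intro hg
    rw [Finset.nonempty_iff_ne_empty]
    rintro rfl
    exact hg.ne' (isCascadeSet_empty_iff.1 h)

theorem IsCascadeSet.unique {n k g : ℕ} {T T' : Finset ℕ} (h : IsCascadeSet n k g T)
    (h' : IsCascadeSet n k g T') : T = T' := by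
  rcases T.eq_empty_or_nonempty with rfl | hT
  · have := isCascadeSet_empty_iff.1 h
    by_contra hne
    have := h'.nonempty_iff.1 (Finset.nonempty_iff_ne_empty.2 (Ne.symm hne))
    omega
  · have hT' := h'.nonempty_iff.2 (h.nonempty_iff.1 hT)
    obtain ⟨u, rfl⟩ := h.exists_word hT
    obtain ⟨u', rfl⟩ := h'.exists_word hT'
    obtain ⟨h1, rfl⟩ := isCascadeSet_wordSet_iff.1 h
    obtain ⟨h2, e⟩ := isCascadeSet_wordSet_iff.1 h'
    rw [h1.eq_of_upCount_eq h2 e]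

theorem familyBound_wordSet {n k : ℕ} (hk : k < n) (u : List Bool) :
    familyBound n k (upCount (n - 1) (n - 1 - k) (u ++ [true])) (wordSet 2 u) =
      pairCount (n - 1) (n - 1 - k) (n - k) (u ++ [true]) := by
  rw [familyBound, dualSet_wordSet, cascadeSum_wordSet, pairCount, dualCount_append_true,
    add_comm, show n + 1 - 2 = n - 1 by omega, Nat.add_sub_cancel]

/-- The words, read from position `5` on, which give the positive resistant numbers. -/
def ResEnd (n k : ℕ) (w : List Bool) : Prop :=
  w = [] ∨ ∃ v, w = v ++ [true] ∧ ResWord (n - 4) (n - 1 - k) (n - k - 3) v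

theorem upCount_cons_true_three (n r : ℕ) (w : List Bool) :
    upCount (n - 1) r (true :: true :: true :: w) = upCount (n - 4) r w := by
  simp only [upCount]
  congr 1

/-- Since `K` does not depend on `w`, totals can be compared after the common prefix, with `n - 4`
points left and `r - s = 2`. -/
theorem pairCount_cons_true_three {n : ℕ} (hn : 4 ≤ n) (r s : ℕ) :
    ∃ K, ∀ w, pairCount (n - 1) r s (true :: true :: true :: w) =
      K + pairCount (n - 4) r (s - 3) w := by
  refine ⟨(n - 2).choose s + (n - 3).choose (s - 1) + (n - 4).choose (s - 2), fun w => ?_⟩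
  rw [show n - 1 = n - 2 + 1 by omega, pairCount_true, show n - 2 = n - 3 + 1 by omega,
    pairCount_true, show n - 3 = n - 4 + 1 by omega, pairCount_true]
  simp only [Nat.sub_sub, Nat.reduceAdd]
  omega

theorem ResEnd.exists_cascadeWord {n k : ℕ} {w : List Bool} (hk : 3 ≤ k) (hn : 2 * k < n)
    (hw : ResEnd n k w) : ∃ u, true :: true :: true :: w = u ++ [true] ∧
      CascadeWord (n - 1) (n - 1 - k) u := by
  rcases hw with rfl | ⟨v, rfl, hv⟩
  · exact ⟨[true, true], rfl, by simp only [CascadeWord]; omega⟩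
  · refine ⟨true :: true :: true :: v, rfl, ?_⟩
    exact ((resWord_iff (c := 5) (e := 2) (by omega) (by omega)).1 hv).1

theorem ResEnd.exists_isCascadeSet {n k : ℕ} {w : List Bool} (hk : 3 ≤ k) (hn : 2 * k < n)
    (hw : ResEnd n k w) : ∃ T, IsCascadeSet n k (upCount (n - 4) (n - 1 - k) w) T ∧
      familyBound n k (upCount (n - 4) (n - 1 - k) w) T =
        pairCount (n - 1) (n - 1 - k) (n - k) (true :: true :: true :: w) := by
  obtain ⟨u, hu, hc⟩ := hw.exists_cascadeWord hk hn
  rw [← upCount_cons_true_three, hu]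
  exact ⟨wordSet 2 u, isCascadeSet_wordSet_iff.2 ⟨hc, rfl⟩, familyBound_wordSet (by omega) u⟩

theorem choose_resistant {n k : ℕ} (hk : 3 ≤ k) (hn : 2 * k < n) :
    (n - 4).choose (n - 1 - k) = (n - 4).choose (k - 3) :=
  Nat.choose_symm_of_eq_add (by omega)

theorem isResistant_zero (n k : ℕ) : IsResistant n k 0 :=
  Or.inr ⟨∅, isCascadeSet_empty_iff.2 rfl, by simp [dualSet], by simp, by simp⟩

theorem ResEnd.isResistant {n k : ℕ} {w : List Bool} (hk : 3 ≤ k) (hn : 2 * k < n)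
    (hw : ResEnd n k w) : IsResistant n k (upCount (n - 4) (n - 1 - k) w) := by
  rcases hw with rfl | ⟨v, rfl, hv⟩
  · exact Or.inl (choose_resistant hk hn)
  · obtain ⟨h1, h2⟩ := (resWord_iff (c := 5) (e := 2) (by omega) (by omega)).1 hv
    have h3 := hv.count_lt (by omega)
    refine Or.inr ⟨wordSet 2 (true :: true :: true :: v), ?_, ?_, ?_, ?_⟩
    · rw [isCascadeSet_wordSet_iff]
      exact ⟨h1, (upCount_cons_true_three _ _ _).symm⟩
    · have e : (v.map (! ·)).count false = v.count true :=
        List.count_map_of_injective v (! ·) (fun a b h => by simpa using h) true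
      rw [dualSet_wordSet, card_wordSet]
      simp [e]
      omega
    · rw [card_wordSet]
      simp
      omega
    · exact (sparseWord_iff 2 2 _).1 h2

theorem IsResistant.exists_resEnd {n k g : ℕ} (hk : 3 ≤ k) (hn : 2 * k < n)
    (h : IsResistant n k g) (hg : 0 < g) :
    ∃ w, ResEnd n k w ∧ g = upCount (n - 4) (n - 1 - k) w := by
  rcases h with rfl | ⟨T, hT, -, -, hs⟩
  · exact ⟨[], Or.inl rfl, (choose_resistant hk hn).symm⟩
  · obtain ⟨u, rfl⟩ := hT.exists_word (hT.nonempty_iff.2 hg)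
    obtain ⟨hc, rfl⟩ := isCascadeSet_wordSet_iff.1 hT
    have hs' : SparseWord 2 2 u := (sparseWord_iff 2 2 u).2 hs
    -- The condition `b₁ > 4` means that positions `2`, `3` and `4` all carry `true`; the other
    -- beginnings violate it.
    rcases u with _ | ⟨_ | _, _ | ⟨_ | _, _ | ⟨_ | _, v⟩⟩⟩ <;>
      simp only [SparseWord] at hs' <;> try omega
    refine ⟨v ++ [true], Or.inr ⟨v, rfl, ?_⟩, upCount_cons_true_three _ _ _⟩
    exact (resWord_iff (c := 5) (e := 2) (by omega) (by omega)).2 ⟨hc, hs'⟩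

theorem ResEnd.fits {n k : ℕ} {w : List Bool} (hk : 3 ≤ k) (hn : 2 * k < n) (hw : ResEnd n k w) :
    Fits (n - 4) (n - 1 - k) w := by
  rcases hw with rfl | ⟨v, rfl, hv⟩
  · simp only [Fits]; omega
  · exact hv.fits

theorem IsResistant.le {n k g : ℕ} (hk : 3 ≤ k) (hn : 2 * k < n) (h : IsResistant n k g) :
    g ≤ (n - 4).choose (k - 3) := by
  rcases g.eq_zero_or_pos with rfl | hg
  · exact Nat.zero_le _
  · obtain ⟨w, hw, rfl⟩ := h.exists_resEnd hk hn hg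
    rw [← choose_resistant hk hn]
    exact upCount_le (hw.fits hk hn)

theorem IsResistant.existsUnique_isCascadeSet {n k g : ℕ} (hk : 3 ≤ k) (hn : 2 * k < n)
    (h : IsResistant n k g) : ∃ T, ∀ T', IsCascadeSet n k g T' ↔ T' = T := by
  obtain ⟨T, hT⟩ : ∃ T, IsCascadeSet n k g T := by
    rcases g.eq_zero_or_pos with rfl | hg
    · exact ⟨∅, isCascadeSet_empty_iff.2 rfl⟩
    · obtain ⟨w, hw, rfl⟩ := h.exists_resEnd hk hn hg
      obtain ⟨T, hT, -⟩ := hw.exists_isCascadeSet hk hn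
      exact ⟨T, hT⟩
  refine ⟨T, fun T' => ⟨fun h' => h'.unique hT, ?_⟩⟩
  rintro rfl
  exact hT

theorem ResEnd.familyBound_eq {n k g : ℕ} {w : List Bool} {T : Finset ℕ} (hk : 3 ≤ k)
    (hn : 2 * k < n) (hw : ResEnd n k w) (hT : IsCascadeSet n k g T)
    (hg : g = upCount (n - 4) (n - 1 - k) w) :
    familyBound n k g T =
      pairCount (n - 1) (n - 1 - k) (n - k) (true :: true :: true :: w) := by
  subst hg
  obtain ⟨T', hT', h⟩ := hw.exists_isCascadeSet hk hn
  rw [hT.unique hT', h]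

theorem ResEnd.familyBound_lt {n k g g' : ℕ} {T T' : Finset ℕ} {w w' : List Bool} (hk : 3 ≤ k)
    (hn : 2 * k < n) (hw : ResEnd n k w) (hw' : ResEnd n k w') (hT : IsCascadeSet n k g T)
    (hT' : IsCascadeSet n k g' T') (hg : g = upCount (n - 4) (n - 1 - k) w)
    (hg' : g' = upCount (n - 4) (n - 1 - k) w') (h : g < g') :
    familyBound n k g' T' < familyBound n k g T := by
  obtain ⟨K, hK⟩ := pairCount_cons_true_three (n := n) (by omega) (n - 1 - k) (n - k)
  rw [hw.familyBound_eq hk hn hT hg, hw'.familyBound_eq hk hn hT' hg', hK, hK]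
  refine Nat.add_lt_add_left ?_ _
  rcases hw with rfl | ⟨v, rfl, hv⟩
  -- The empty word gives the largest resistant number, so nothing lies above it.
  · have := upCount_le (hw'.fits hk hn)
    simp only [upCount] at hg
    omega
  · rcases hw' with rfl | ⟨v', rfl, hv'⟩
    · rw [pairCount_nil]
      exact choose_lt_pairCount (by omega) (by omega) hv
    · exact pairCount_anti (by omega) (by omega) hv hv' (by omega)

/-- The upper bound: `g` is the smallest resistant number which is at least the diversity. -/
theorem card_le_familyBound {n k g : ℕ} {T : Finset ℕ} {F : Finset (Finset ℕ)} (hk : 3 ≤ k)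
    (hn : 2 * k < n) (hF : IsIntersectingFamily n k F) (hpos : 0 < diversity n F)
    (hg : IsResistant n k g) (hT : IsCascadeSet n k g T) (hle : diversity n F ≤ g)
    (hmin : ∀ g', IsResistant n k g' → diversity n F ≤ g' → g ≤ g') :
    F.card ≤ familyBound n k g T := by
  obtain ⟨K, hK⟩ := pairCount_cons_true_three (n := n) (by omega) (n - 1 - k) (n - k)
  have hgle := hg.le hk hn
  rw [← choose_resistant hk hn] at hgle
  obtain ⟨w, hw, hwd⟩ := exists_upCount_eq hpos (hle.trans hgle)
  have hw3 : Fits (n - 1) (n - 1 - k) (true :: true :: true :: w) :=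
    ⟨by omega, by omega, by omega, hw⟩
  have h1 := card_le_pairCount (by omega) hn hF hw3 (by rw [upCount_cons_true_three, hwd])
  obtain ⟨w', hw', hu, hp, hm⟩ :=
    exists_resWord_ge (s := n - k - 3) (by omega) (by omega) hw
  have hw'' : ResEnd n k w' := hw'
  have hge := hmin _ (hw''.isResistant hk hn) (hwd ▸ hu)
  -- As `g` is itself resistant and at least the diversity, minimality of the truncated word bounds
  -- its count by `g`. With `hge`, this count equals `g`.
  have hle' : upCount (n - 4) (n - 1 - k) w' ≤ g := by
    obtain ⟨w₁, hw₁, hg₁⟩ := hg.exists_resEnd hk hn (by omega)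
    rcases hw₁ with rfl | ⟨v, rfl, hv⟩
    · rw [hg₁]
      exact upCount_le (hw''.fits hk hn)
    · rw [hg₁]
      exact (hm v hv (by omega)).1
  rw [hw''.familyBound_eq hk hn hT (le_antisymm hge hle')]
  rw [hK] at h1 ⊢
  omega

theorem mainTheorem1 (n k : ℕ) (hk : 6 ≤ 2 * k) (hn : 2 * k < n) :
    ∃ (m : ℕ) (γ : Fin (m + 1) → ℕ) (T : Fin (m + 1) → Finset ℕ),
      -- `γ` lists all resistant numbers in increasing order, `γ₀ = 0`, `γ_m = (n-4 choose k-3)`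
      StrictMono γ ∧ Set.range γ = {g : ℕ | IsResistant n k g} ∧
      γ 0 = 0 ∧ γ (Fin.last m) = (n - 4).choose (k - 3) ∧
      -- `T l` is the set `T_{γ_l}` of the unique cascade form of `γ_l`
      (∀ (l : Fin (m + 1)) (T' : Finset ℕ), IsCascadeSet n k (γ l) T' ↔ T' = T l) ∧
      -- the upper bound
      (∀ (l : Fin m) (F : Finset (Finset ℕ)), IsIntersectingFamily n k F →
        γ l.castSucc < diversity n F → diversity n F ≤ γ l.succ →
        F.card ≤ familyBound n k (γ l.succ) (T l.succ)) ∧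
      -- the bound strictly decreases in `l ∈ {1, …, m}`
      StrictAnti (fun l : Fin m => familyBound n k (γ l.succ) (T l.succ)) ∧
      -- the bound is attained, with diversity `γ_l`, for every `l ∈ {1, …, m}`
      (∀ l : Fin m, ∃ F : Finset (Finset ℕ), IsIntersectingFamily n k F ∧
        diversity n F = γ l.succ ∧
        F.card = familyBound n k (γ l.succ) (T l.succ)) := by
  classical
  replace hk : 3 ≤ k := by omega
  set R : Finset ℕ := (Finset.range ((n - 4).choose (k - 3) + 1)).filter (IsResistant n k) with hR
  have hmem : ∀ g, g ∈ R ↔ IsResistant n k g := by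
    intro g
    rw [hR, Finset.mem_filter, Finset.mem_range, and_iff_right_iff_imp]
    intro h
    have := h.le hk hn
    omega
  have h0 : 0 ∈ R := (hmem 0).2 (isResistant_zero n k)
  have hlast : (n - 4).choose (k - 3) ∈ R := (hmem _).2 (Or.inl rfl)
  have hcard : R.card = (R.card - 1) + 1 := by
    have := Finset.card_pos.2 ⟨0, h0⟩
    omega
  set γ := R.orderEmbOfFin hcard with hγ
  have hγmem : ∀ l, IsResistant n k (γ l) := fun l => (hmem _).1 (Finset.orderEmbOfFin_mem R hcard l)
  have hmono : StrictMono γ := γ.strictMono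
  have hγ0 : γ 0 = 0 := by
    obtain ⟨j, hj⟩ : (0 : ℕ) ∈ Set.range γ := by
      rw [Finset.range_orderEmbOfFin]
      exact h0
    have := hmono.monotone (Fin.zero_le j)
    omega
  have hsurj : ∀ g, IsResistant n k g → ∃ j, γ j = g := by
    intro g hg
    have : g ∈ Set.range γ := by
      rw [Finset.range_orderEmbOfFin]
      exact (hmem g).2 hg
    exact this
  choose T hT using fun l => (hγmem l).existsUnique_isCascadeSet hk hn
  have hTc : ∀ l, IsCascadeSet n k (γ l) (T l) := fun l => (hT l (T l)).2 rfl
  have hpos : ∀ l : Fin (R.card - 1), 0 < γ l.succ := fun l =>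
    hγ0 ▸ hmono (Fin.succ_pos l)
  refine ⟨R.card - 1, γ, T, hmono, ?_, hγ0, ?_, hT, ?_, ?_, ?_⟩
  · ext g
    constructor
    · rintro ⟨l, rfl⟩
      exact hγmem l
    · exact hsurj g
  · obtain ⟨j, hj⟩ := hsurj _ (Or.inl rfl)
    refine le_antisymm ((hγmem _).le hk hn) ?_
    rw [← hj]
    exact hmono.monotone (Fin.le_last j)
  · intro l F hF h1 h2
    refine card_le_familyBound hk hn hF (by omega) (hγmem _) (hTc _) h2 ?_
    intro g hg hle
    obtain ⟨j, rfl⟩ := hsurj g hg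
    -- A resistant number at least the diversity exceeds `γ_{l-1}`, and the enumeration is
    -- exhaustive, so it is at least `γ_l`.
    have : l.castSucc < j := hmono.lt_iff_lt.1 (h1.trans_le hle)
    exact hmono.monotone (Fin.castSucc_lt_iff_succ_le.1 this)
  · intro i j hij
    obtain ⟨w, hw, hg⟩ := (hγmem i.succ).exists_resEnd hk hn (hpos i)
    obtain ⟨w', hw', hg'⟩ := (hγmem j.succ).exists_resEnd hk hn (hpos j)
    exact hw.familyBound_lt hk hn hw' (hTc _) (hTc _) hg hg' (hmono (Fin.succ_lt_succ_iff.2 hij))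
  · intro l
    obtain ⟨w, hw, hg⟩ := (hγmem l.succ).exists_resEnd hk hn (hpos l)
    have hw3 : Fits (n - 1) (n - 1 - k) (true :: true :: true :: w) :=
      ⟨by omega, by omega, by omega, hw.fits hk hn⟩
    obtain ⟨F, hF, hd, hc⟩ := exists_family hk hn hw3
      (by rw [upCount_cons_true_three, ← hg]; exact (hγmem _).le hk hn)
    refine ⟨F, hF, ?_, ?_⟩
    · rw [hd, upCount_cons_true_three, ← hg]
    · rw [hc, hw.familyBound_eq hk hn (hTc _) hg]
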